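/- Let $X$ be a separable real Hilbert space, $Y=\mathbb R^J$ with the Euclidean norm $|\cdot|$, and $\mathcal G_a:X\to Y$ a measurable map. Let $x$ be an $X$-valued random variable and let $\epsilon,\eta$ be $Y$-valued random variables such that $(\epsilon,x)$ is jointly Gaussian on $Y\times X$, $\eta\sim\mathbb Q_0=\mathcal N(0,\mathcal C_\eta)$, and $\eta$ is independent of $(\epsilon,x)$. (Gaussian measures may be degenerate.) Put $y=\mathcal G_a(x)+\epsilon+\eta$. Let $\mu_0=\mathcal N(\bar x,\mathcal C_x)$ be the law of $x$, let $\mathcal N(\bar\epsilon,\mathcal C_\epsilon)$ be the law of $\epsilon$, and let $\mathcal C_{x\epsilon}=\mathbb E(x-\bar x)\otimes(\epsilon-\bar\epsilon)$, $\mathcal C_{\epsilon x}=\mathcal C_{x\epsilon}^*$. Put $$\bar\nu_x=\bar\epsilon+\mathcal C_{\epsilon x}\mathcal C_x^{-1}(x-\bar x),\qquad \mathcal C_{\nu|x}=\mathcal C_\eta+\mathcal C_\epsilon-\mathcal C_{\epsilon x}\mathcal C_x^{-1}\mathcal C_{x\epsilon},\qquad \tilde{\mathbb Q}_x=\mathcal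 N(\mathcal G_a(x)+\bar\nu_x,\mathcal C_{\nu|x}).$$ Here, for $h$ in the Cameron–Martin space of $\mu_0$, $\langle\mathcal C_x^{-1}h,\,\cdot-\bar x\rangle$ denotes the element $f$ of the $L^2(\mu_0)$-closure of $\{\langle u,\cdot-\bar x\rangle:u\in X\}$ with $\int f(z)\langle u,z-\bar x\rangle\,\mu_0(dz)=\langle h,u\rangle$ for all $u\in X$, and $\langle\mathcal C_x^{-1}h,k\rangle$ is the $L^2(\mu_0)$ inner product of the functions so attached to $h$ and $k$. These conventions are applied with $h,k\in\operatorname{Im}\mathcal C_{x\epsilon}$, which is contained in the Cameron–Martin space; $\bar\nu_x$ is thus defined for $\mu_0$-a.e. $x$. Let $\varsigma$ be the law of $(x,y)$. Assume that 1. $\operatorname{Im}(\mathcal C_\eta^{1/2})=\operatorname{Im}(\mathcal C_{\nu|x}^{1/2})=:E$; 2. $\mathcal G_a(x)+\bar\nu_x\in E$ for $\mu_0$-a.e. $x$; 3. $T:=(\mathcal C_\eta^{-1/2}\mathcal C_{\nu|x}^{1/2})(\mathcal C_\eta^{-1/2}\mathcal C_{\nu|x}^{1/2})^*-I$ is Hilbert–Schmidt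 on $\bar E$, where $\mathcal C_\eta^{-1/2}$ is the pseudo-inverse of $\mathcal C_\eta^{1/2}$. Let $\Phi:X\times Y\to\mathbb R$ be $\mu_0\otimes\mathbb Q_0$-measurable and such that, for some measurable $c:Y\to(0,\infty)$ and for $\mu_0$-a.e. $x$, $$\frac{d\tilde{\mathbb Q}_x}{d\mathbb Q_0}(y)=\frac1{c(y)}\exp(-\Phi(x;y))\qquad\text{for }\mathbb Q_0\text{-a.e. }y,$$ and assume that $Z(y):=\int_X\exp(-\Phi(x;y))\,\mu_0(dx)>0$ for $\mathbb Q_0$-a.e. $y$. Then $\varsigma(dx,dy)=\mu_0(dx)\,\tilde{\mathbb Q}_x(dy)$. The (regular) conditional distribution $\mu^y$ of $x$ given $y$ exists under $\varsigma$ and, for $\varsigma$-a.e. $y$, one has $0<Z(y)<\infty$, $\mu^y\ll\mu_0$ and $$\frac{d\mu^y}{d\mu_0}(x)=\frac1{Z(y)}\exp(-\Phi(x;y)).\tag{$*$}$$ Suppose in addition that $\Phi$ satisfies the following bounds: * for all $\delta>0$, $r>0$ there is $M\in\mathbb R$ with $\Phi(x;y)\ge M-\delta\|x\|^2$ for all $x\in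 X$, $|y|<r$; * there is $p>0$ and for all $r>0$ there is $K_1>0$ with $\Phi(x;y)\le K_1(1+\|x\|^p)$ for all $x\in X$, $|y|<r$; * for all $r>0$ there is $K_2>0$ with $|\Phi(x_1;y)-\Phi(x_2;y)|\le K_2\|x_1-x_2\|$ whenever $\|x_1\|,\|x_2\|,|y|<r$; * there is $q\ge0$ and for all $r>0$ there is $K_3>0$ with $|\Phi(x;y_1)-\Phi(x;y_2)|\le K_3(1+\|x\|^q)|y_1-y_2|$ for all $x\in X$ and $|y_1|,|y_2|<r$. Then $0<Z(y)<\infty$ for every $y\in Y$, so that $(*)$ defines a probability measure $\mu^y$ for every $y$. For every $r>0$ there is $C=C(r)>0$ such that $$d_{\mathrm{Hell}}(\mu^y,\mu^{y'})\le C|y-y'|\qquad\text{for all }|y|,|y'|\le r,$$ where $d_{\mathrm{Hell}}(\mu,\mu')^2=\frac12\int\big(\sqrt{d\mu/d\nu}-\sqrt{d\mu'/d\nu}\big)^2d\nu$ for any common reference measure $\nu$. For every strongly $\mu_0$-measurable $f:X\to F$, $F$ a Banach space, with $\|f(x)\|\le K(1+\|x\|^n)$ for some $K\in\mathbb R$ and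 $n\in\mathbb N$, $f$ is $\mu^y$-integrable for every $y$ and $y\mapsto\int f\,d\mu^y$ is continuous. In particular $\mu^y$ has finite second moment, and its mean and its covariance operator (in operator norm) are continuous in $y$. -/

import Mathlib

open MeasureTheory ProbabilityTheory Filter Topology
open scoped ENNReal MatrixOrder

noncomputable section

namespace ModelErrorBayes

/-! ### Gaussian conditioning -/

section Gaussian

variable {Ω : Type*} [MeasurableSpace Ω]
  {X : Type*} [NormedAddCommGroup X] [InnerProductSpace ℝ X] [MeasurableSpace X]

/-- The (cross-)covariance operator `E (a - E a) ⊗ (b - E b)` of two Hilbert space valued random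
variables, acting by `v ↦ E [⟪b - E b, v⟫ (a - E a)]`. -/
def crossCov {E F : Type*} [NormedAddCommGroup E] [InnerProductSpace ℝ E]
    [NormedAddCommGroup F] [InnerProductSpace ℝ F]
    (P : Measure Ω) (a : Ω → E) (b : Ω → F) (v : F) : E :=
  ∫ ω, (inner ℝ (b ω - ∫ ω', b ω' ∂P) v) • (a ω - ∫ ω', a ω' ∂P) ∂P

/-- The covariance matrix of an `ℝ^J`-valued random variable. -/
def covMatrix {J : ℕ} (P : Measure Ω) (b : Ω → EuclideanSpace ℝ (Fin J)) :
    Matrix (Fin J) (Fin J) ℝ :=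
  Matrix.of fun i j => crossCov P b b (EuclideanSpace.single j 1) i

/-- The Gaussian Hilbert space of a measure `μ` on `X` with mean `a`: the closure in `L²(μ)` of the
functions `z ↦ ⟪u, z - a⟫`, for `u` in `X`. -/
def gaussianHilbert (μ : Measure X) : Set (Lp ℝ 2 μ) :=
  closure {f | ∃ u : X, f =ᵐ[μ] fun z => inner ℝ u (z - ∫ z', z' ∂μ)}

/-- `f` represents `h` if it lies in the Gaussian Hilbert space and
`∫ f(z) (z - a) μ(dz) = h` weakly. There is at most one such `f`, and there is one exactly if `h`
lies in the Cameron-Martin space `Im (C^{1/2})` of `μ = N(a, C)`. If `h = C u`, it is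
`z ↦ ⟪u, z - a⟫`. -/
def Represents (μ : Measure X) (h : X) (f : Lp ℝ 2 μ) : Prop :=
  f ∈ gaussianHilbert μ ∧
    ∀ u : X, ∫ z, f z * inner ℝ u (z - ∫ z', z' ∂μ) ∂μ = inner ℝ h u

open Classical in
/-- The function `z ↦ ⟪C⁻¹ h, z - a⟫` of `L²(μ)`, for `μ = N(a, C)` and `h` in the Cameron-Martin
space of `μ` (the Paley-Wiener map): the usual meaning of this expression when `C⁻¹` is
unbounded. The value is `0` if `h` is not in the Cameron-Martin space. -/
def invCovInner (μ : Measure X) (h : X) : Lp ℝ 2 μ :=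
  if H : ∃ f, Represents μ h f then H.choose else 0

variable {J : ℕ}

/-- The conditional mean `E ε + C_{εx} C_x⁻¹ (z - E x)` of `ε` given `x = z`; its `j`-th coordinate
is `E ε_j + ⟪C_x⁻¹ C_{xε} e_j, z - E x⟫`. It is determined up to a null set of the law of `x`. -/
def nuBar (P : Measure Ω) (x : Ω → X) (ε : Ω → EuclideanSpace ℝ (Fin J)) (z : X) :
    EuclideanSpace ℝ (Fin J) :=
  (∫ ω, ε ω ∂P) + WithLp.toLp 2 fun j =>
    invCovInner (P.map x) (crossCov P x ε (EuclideanSpace.single j 1)) z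

/-- The matrix `C_{εx} C_x⁻¹ C_{xε}`, with entries `⟪C_x⁻¹ C_{xε} e_i, C_{xε} e_j⟫`, where
`⟪C⁻¹ h, k⟫` is the inner product of the Cameron-Martin space, that is, the `L²` inner product of
the functions `⟪C⁻¹ h, · - a⟫` and `⟪C⁻¹ k, · - a⟫`. -/
def gainMatrix (P : Measure Ω) (x : Ω → X) (ε : Ω → EuclideanSpace ℝ (Fin J)) :
    Matrix (Fin J) (Fin J) ℝ :=
  Matrix.of fun i j =>
    inner ℝ (invCovInner (P.map x) (crossCov P x ε (EuclideanSpace.single i 1)))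
      (invCovInner (P.map x) (crossCov P x ε (EuclideanSpace.single j 1)))

/-- The conditional covariance `C_η + C_ε - C_{εx} C_x⁻¹ C_{xε}` of `ν = ε + η` given `x`. -/
def covNu (P : Measure Ω) (x : Ω → X) (ε η : Ω → EuclideanSpace ℝ (Fin J)) :
    Matrix (Fin J) (Fin J) ℝ :=
  covMatrix P η + covMatrix P ε - gainMatrix P x ε

/-- The law `N(G(z) + nuBar z, C_{ν|x})` of `y = G(x) + ε + η` given `x = z`. -/
def condLaw (P : Measure Ω) (G : X → EuclideanSpace ℝ (Fin J)) (x : Ω → X)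
    (ε η : Ω → EuclideanSpace ℝ (Fin J)) (z : X) : Measure (EuclideanSpace ℝ (Fin J)) :=
  multivariateGaussian (G z + nuBar P x ε z) (covNu P x ε η)

end Gaussian

/-! ### Operators on `ℝ^J` -/

section Operators

variable {J : ℕ}

/-- `Im (S^{1/2})`, as a subspace of `ℝ^J`, for a positive semidefinite matrix `S`. -/
def rangeSqrt (S : Matrix (Fin J) (Fin J) ℝ) : Submodule ℝ (EuclideanSpace ℝ (Fin J)) :=
  LinearMap.range (Matrix.toEuclideanLin (CFC.sqrt S))

/-- `S^{-1/2}`, the Moore-Penrose inverse of `S^{1/2}`, for a positive semidefinite matrix `S`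
(functional calculus with `t ↦ t^{-1/2}` for `t > 0` and `0 ↦ 0`). -/
def invSqrt (S : Matrix (Fin J) (Fin J) ℝ) : Matrix (Fin J) (Fin J) ℝ :=
  cfc (fun t : ℝ => (Real.sqrt t)⁻¹) S

/-- The operator `(S₀^{-1/2} S₁^{1/2}) (S₀^{-1/2} S₁^{1/2})^* - I`. -/
def feldmanHajekOp (S₀ S₁ : Matrix (Fin J) (Fin J) ℝ) : Matrix (Fin J) (Fin J) ℝ :=
  (invSqrt S₀ * CFC.sqrt S₁) * (invSqrt S₀ * CFC.sqrt S₁).transpose - 1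

/-- The linear map `T` is Hilbert-Schmidt on the subspace `K`: `∑ ‖T b_i‖² < ∞` for an orthonormal
basis `b` of `K`. -/
def IsHilbertSchmidtOn {H : Type*} [NormedAddCommGroup H] [InnerProductSpace ℝ H]
    (T : H →ₗ[ℝ] H) (K : Submodule ℝ H) : Prop :=
  ∃ (s : Set K) (b : HilbertBasis s ℝ K), Summable fun i => ‖T (b i : H)‖ ^ 2

end Operators

/-! ### Potential and posterior -/

section Posterior

/-- The growth and Lipschitz bounds on the potential. -/
structure PotentialBounds {X Y : Type*} [NormedAddCommGroup X] [NormedAddCommGroup Y]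
    (Φ : X → Y → ℝ) : Prop where
  lower : ∀ δ > 0, ∀ r > 0, ∃ M : ℝ, ∀ x : X, ∀ y : Y, ‖y‖ < r → M - δ * ‖x‖ ^ 2 ≤ Φ x y
  upper : ∃ p : ℝ, 0 < p ∧ ∀ r > 0, ∃ K₁ > 0, ∀ x : X, ∀ y : Y, ‖y‖ < r →
    Φ x y ≤ K₁ * (1 + ‖x‖ ^ p)
  lipschitz_left : ∀ r > 0, ∃ K₂ > 0, ∀ x₁ x₂ : X, ∀ y : Y,
    ‖x₁‖ < r → ‖x₂‖ < r → ‖y‖ < r → |Φ x₁ y - Φ x₂ y| ≤ K₂ * ‖x₁ - x₂‖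
  lipschitz_right : ∃ q : ℝ, 0 ≤ q ∧ ∀ r > 0, ∃ K₃ > 0, ∀ y₁ y₂ : Y, ∀ x : X,
    ‖y₁‖ < r → ‖y₂‖ < r → |Φ x y₁ - Φ x y₂| ≤ K₃ * (1 + ‖x‖ ^ q) * ‖y₁ - y₂‖

variable {X Y : Type*} [MeasurableSpace X]

/-- The normalising constant `Z(y) = ∫ exp (-Φ(x; y)) μ₀(dx)`. -/
def normConst (μ₀ : Measure X) (Φ : X → Y → ℝ) (y : Y) : ℝ≥0∞ :=
  ∫⁻ x, ENNReal.ofReal (Real.exp (-Φ x y)) ∂μ₀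

/-- The density `exp (-Φ(x; y)) / Z(y)`. -/
def posteriorDensity (μ₀ : Measure X) (Φ : X → Y → ℝ) (y : Y) (x : X) : ℝ≥0∞ :=
  ENNReal.ofReal (Real.exp (-Φ x y)) / normConst μ₀ Φ y

/-- The measure with density `exp (-Φ(x; y)) / Z(y)` with respect to `μ₀`. -/
def posterior (μ₀ : Measure X) (Φ : X → Y → ℝ) (y : Y) : Measure X :=
  μ₀.withDensity (posteriorDensity μ₀ Φ y)

/-- The Hellinger distance, with `μ + μ'` as the common reference measure. -/
def hellinger (μ μ' : Measure X) : ℝ :=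
  Real.sqrt ((1 / 2) * ∫ x, (Real.sqrt (μ.rnDeriv (μ + μ') x).toReal
    - Real.sqrt (μ'.rnDeriv (μ + μ') x).toReal) ^ 2 ∂(μ + μ'))

/-- The (centred) covariance operator of a measure on a Hilbert space. -/
def covOp {X : Type*} [NormedAddCommGroup X] [InnerProductSpace ℝ X] [CompleteSpace X]
    [MeasurableSpace X] [BorelSpace X] (μ : Measure X) : X →L[ℝ] X :=
  InnerProductSpace.continuousLinearMapOfBilin (covarianceBilin μ)

end Posterior

end ModelErrorBayes

end

/-!
The theorem combines three facts.

*The joint law.* Put `b = ε + η`. In `L²(P)`, the variables `f` with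
`E exp (i f) = exp (-‖f‖² / 2)` form a closed set containing the centred Gaussian variables. The
function attached to `C_{xb} t` is the orthogonal projection of `⟪t, b - E b⟫` on the Gaussian
Hilbert space of `x`, hence a limit of linear functionals of `x`, so that the residual
`⟪t, b - E b⟫ - regression t (x)` plus any linear functional of `x` is in this closed set, and the
two summands are orthogonal. The characteristic function of the pair (`x`, residual) therefore
factorises (`map_residual_eq_prod`): the residual is independent of `x` with law
`N(0, C_b - C_{bx} C_x⁻¹ C_{xb})`. As `η` is centred and independent of `(ε, x)`, this covariance is
`C_{ν|x}` and the regression of `b` on `x` is that of `ε`, which gives the disintegration of the law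
of `(x, y)` (`map_prod_eq_lintegral_condLaw`).

*Bayes' formula.* The assumption on the Radon-Nikodym derivative determines the conditional law of
`y` given `x` only if that law is absolutely continuous with respect to the law of `η`. In finite
dimension this follows from the equality of the ranges of the square roots of the covariances: two
symmetric maps with equal ranges differ by an invertible factor, and the standard Gaussian measure
is quasi-invariant under invertible affine maps (`multivariateGaussian_absolutelyContinuous`). The
joint law then has a density with respect to the product of the laws of `x` and `η`, and the
conditional density of `x` is obtained by normalising it (`exists_kernel_posteriorDensity`).

*Stability.* By Fernique's theorem there is `a > 0` such that `exp (4 a ‖x‖²)` is integrable with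
respect to the prior. For data in a ball, `exp (-Φ)`, the Lipschitz constant of `Φ(x; ·)` and
functions of polynomial growth are all dominated by multiples of `exp (a ‖x‖²)`, and the evidence
`Z` is bounded below and Lipschitz. Writing the posterior density as `exp (-(Φ + log Z))` gives
Lipschitz bounds for the density and its square root, with integrable constants
(`PotentialBounds.exists_density_bounds`). The Hellinger estimate and the continuity of
posterior expectations follow; the covariance operator is the case of the operator-valued
function `z ↦ z ⊗ z`.
-/

namespace ModelErrorBayes

/-! ### Random variables with a Gaussian characteristic function in `L²` -/

section Gaussian

variable {Ω : Type*} [MeasurableSpace Ω] {P : Measure Ω} [IsProbabilityMeasure P]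

/-- The characteristic function at `1` is `1`-Lipschitz as a function on `L²(P)`. -/
lemma norm_integral_exp_sub_le (f g : Lp ℝ 2 P) :
    ‖(∫ ω, Complex.exp (f ω * Complex.I) ∂P) - ∫ ω, Complex.exp (g ω * Complex.I) ∂P‖
      ≤ ‖f - g‖ := by
  have hint : ∀ h : Lp ℝ 2 P, Integrable (fun ω => Complex.exp (h ω * Complex.I)) P := by
    intro h
    have hm : AEStronglyMeasurable (fun ω => Complex.exp (h ω * Complex.I)) P := by
      have := (Lp.aestronglyMeasurable h).aemeasurable
      exact AEMeasurable.aestronglyMeasurable (by fun_prop)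
    refine Integrable.of_bound hm 1 (ae_of_all _ fun ω => ?_)
    rw [Complex.norm_exp_ofReal_mul_I]
  have hd : MemLp (⇑(f - g)) 1 P := (Lp.memLp (f - g)).mono_exponent (by norm_num)
  rw [← integral_sub (hint f) (hint g)]
  calc ‖∫ ω, (Complex.exp (f ω * Complex.I) - Complex.exp (g ω * Complex.I)) ∂P‖
      ≤ ∫ ω, ‖(f - g) ω‖ ∂P := by
        refine norm_integral_le_of_norm_le (memLp_one_iff_integrable.1 hd).norm ?_
        filter_upwards [Lp.coeFn_sub f g] with ω hω
        have h1 : Complex.exp (f ω * Complex.I) - Complex.exp (g ω * Complex.I)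
            = Complex.exp (g ω * Complex.I) *
              (Complex.exp (Complex.I * ((f ω - g ω : ℝ) : ℂ)) - 1) := by
          rw [mul_sub, ← Complex.exp_add, mul_one]
          congr 2
          push_cast
          ring
        rw [h1, norm_mul, Complex.norm_exp_ofReal_mul_I, one_mul, hω]
        exact Real.norm_exp_I_mul_ofReal_sub_one_le
    _ = (eLpNorm (⇑(f - g)) 1 P).toReal := by
        rw [eLpNorm_one_eq_lintegral_enorm,
          integral_norm_eq_lintegral_enorm hd.aestronglyMeasurable]
    _ ≤ ‖f - g‖ := by
        rw [Lp.norm_def]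
        exact ENNReal.toReal_mono (Lp.eLpNorm_ne_top _)
          (eLpNorm_le_eLpNorm_of_exponent_le (by norm_num) (Lp.aestronglyMeasurable _))

variable (P) in
/-- The elements `f` of `L²(P)` with `E exp (i f) = exp (-‖f‖² / 2)`; these include the centred
Gaussian random variables. -/
def gaussianCharSet : Set (Lp ℝ 2 P) :=
  {f | ∫ ω, Complex.exp (f ω * Complex.I) ∂P = Complex.exp (-(‖f‖ ^ 2 / 2 : ℝ))}

/-- `L²` limits of centred Gaussian variables still have the Gaussian characteristic function. -/
lemma isClosed_gaussianCharSet : IsClosed (gaussianCharSet P) := by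
  have h : LipschitzWith 1 fun f : Lp ℝ 2 P => ∫ ω, Complex.exp (f ω * Complex.I) ∂P :=
    LipschitzWith.of_dist_le_mul fun f g => by
      simpa [dist_eq_norm] using norm_integral_exp_sub_le f g
  exact isClosed_eq h.continuous (by fun_prop)

omit [IsProbabilityMeasure P] in
lemma toLp_mem_gaussianCharSet {f : Ω → ℝ} (hf : HasGaussianLaw f P) (h0 : ∫ ω, f ω ∂P = 0)
    (hm : MemLp f 2 P) : hm.toLp f ∈ gaussianCharSet P := by
  have h1 := hf.charFun_map_eq (1 : ℝ)
  rw [charFun_apply_real, integral_map hf.aemeasurable (by fun_prop)] at h1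
  have h3 : ∀ r : ℝ, inner ℝ (1 : ℝ) r = r := fun r => by simp
  simp only [h3, h0, Complex.ofReal_one, one_mul, Complex.ofReal_zero, zero_mul, zero_sub] at h1
  have hn : ‖hm.toLp f‖ ^ 2 = Var[f; P] := by
    rw [variance_of_integral_eq_zero hf.aemeasurable h0, ← real_inner_self_eq_norm_sq,
      L2.inner_def]
    refine integral_congr_ae ?_
    filter_upwards [hm.coeFn_toLp] with ω hω
    simp [hω, sq]
  rw [gaussianCharSet, Set.mem_ofPred_eq, hn]
  have h2 : ∫ ω, Complex.exp (hm.toLp f ω * Complex.I) ∂P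
      = ∫ ω, Complex.exp (f ω * Complex.I) ∂P := by
    refine integral_congr_ae ?_
    filter_upwards [hm.coeFn_toLp] with ω hω
    rw [hω]
  rw [h2]
  rw [h1]
  push_cast
  rfl

variable {E : Type*} [NormedAddCommGroup E] [InnerProductSpace ℝ E]
  {F : Type*} [NormedAddCommGroup F] [InnerProductSpace ℝ F]

/-- The linear map `u ↦ ⟪u, a - E a⟫` from `E` to `L²(P)`, for a square integrable random variable
`a` with values in `E`. -/
noncomputable def centredInner {a : Ω → E} (ha : MemLp a 2 P) : E →ₗ[ℝ] Lp ℝ 2 P where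
  toFun u := ((ha.sub (memLp_const (∫ ω, a ω ∂P))).const_inner u).toLp
  map_add' u v := by
    rw [← MemLp.toLp_add]
    congr 1
    ext ω
    simp [inner_add_left]
  map_smul' c u := by
    rw [RingHom.id_apply, ← MemLp.toLp_const_smul]
    congr 1
    ext ω
    simp [inner_smul_left]

lemma coeFn_centredInner {a : Ω → E} (ha : MemLp a 2 P) (u : E) :
    centredInner ha u =ᵐ[P] fun ω => inner ℝ u (a ω - ∫ ω', a ω' ∂P) :=
  MemLp.coeFn_toLp ((ha.sub (memLp_const (∫ ω, a ω ∂P))).const_inner u)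

lemma inner_centredInner {a : Ω → E} {b : Ω → F} (ha : MemLp a 2 P) (hb : MemLp b 2 P)
    [CompleteSpace E] (u : E) (v : F) :
    inner ℝ (centredInner hb v) (centredInner ha u) = inner ℝ (crossCov P a b v) u := by
  have ha' := ha.sub (memLp_const (μ := P) (∫ ω, a ω ∂P))
  have hb' := hb.sub (memLp_const (μ := P) (∫ ω, b ω ∂P))
  have hint : Integrable (fun ω => (inner ℝ (b ω - ∫ ω', b ω' ∂P) v)
      • (a ω - ∫ ω', a ω' ∂P)) P := memLp_one_iff_integrable.1 (ha'.smul (hb'.inner_const v))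
  rw [crossCov, real_inner_comm _ (∫ _, _ ∂P), ← integral_inner hint, L2.inner_def]
  refine integral_congr_ae ?_
  filter_upwards [coeFn_centredInner ha u, coeFn_centredInner hb v] with ω h1 h2
  simp [h1, h2, inner_smul_right, real_inner_comm, mul_comm]

lemma covMatrix_apply {J : ℕ} {b : Ω → EuclideanSpace ℝ (Fin J)} (hb : MemLp b 2 P)
    (i j : Fin J) :
    covMatrix P b i j = inner ℝ (centredInner hb (EuclideanSpace.single i 1))
      (centredInner hb (EuclideanSpace.single j 1)) := by
  rw [real_inner_comm, inner_centredInner, covMatrix, Matrix.of_apply]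
  simp [EuclideanSpace.inner_single_right]

lemma centredInner_eq_sum {J : ℕ} {b : Ω → EuclideanSpace ℝ (Fin J)} (hb : MemLp b 2 P)
    (t : EuclideanSpace ℝ (Fin J)) :
    centredInner hb t = ∑ j, t j • centredInner hb (EuclideanSpace.single j 1) := by
  conv_lhs => rw [← (EuclideanSpace.basisFun (Fin J) ℝ).sum_repr t]
  simp

lemma dotProduct_covMatrix_mulVec {J : ℕ} {b : Ω → EuclideanSpace ℝ (Fin J)} (hb : MemLp b 2 P)
    (t : EuclideanSpace ℝ (Fin J)) :
    t.ofLp ⬝ᵥ (covMatrix P b).mulVec t.ofLp = ‖centredInner hb t‖ ^ 2 := by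
  rw [← real_inner_self_eq_norm_sq, centredInner_eq_sum]
  simp only [dotProduct, Matrix.mulVec, covMatrix_apply hb, sum_inner, inner_sum,
    real_inner_smul_left, real_inner_smul_right, Finset.mul_sum]
  exact Finset.sum_congr rfl fun i _ => Finset.sum_congr rfl fun j _ => by
    rw [real_inner_comm (centredInner hb (EuclideanSpace.single i 1))]; ring

lemma posSemidef_covMatrix {J : ℕ} {b : Ω → EuclideanSpace ℝ (Fin J)} (hb : MemLp b 2 P) :
    (covMatrix P b).PosSemidef := by
  refine Matrix.PosSemidef.of_dotProduct_mulVec_nonneg ?_ fun t => ?_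
  · ext i j
    simp [Matrix.conjTranspose_apply, covMatrix_apply hb, real_inner_comm]
  · have := dotProduct_covMatrix_mulVec hb (WithLp.toLp 2 t)
    simp only at this
    simp only [star_trivial]
    rw [this]
    positivity

end Gaussian

/-! ### The Paley-Wiener map and Gaussian conditioning -/

section PaleyWiener

variable {Ω : Type*} [MeasurableSpace Ω] {P : Measure Ω} [IsProbabilityMeasure P]
  {X : Type*} [NormedAddCommGroup X] [InnerProductSpace ℝ X]
  [MeasurableSpace X] {F : Type*} [NormedAddCommGroup F] [InnerProductSpace ℝ F]

lemma gaussianHilbert_eq {μ : Measure X} [IsProbabilityMeasure μ] (h : MemLp id 2 μ) :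
    gaussianHilbert μ = (LinearMap.range (centredInner h)).topologicalClosure := by
  rw [gaussianHilbert, Submodule.topologicalClosure_coe]
  congr 1
  ext f
  rw [Set.mem_ofPred_eq]
  constructor
  · rintro ⟨u, hu⟩
    exact ⟨u, Lp.ext ((coeFn_centredInner h u).trans hu.symm)⟩
  · rintro ⟨u, rfl⟩
    exact ⟨u, coeFn_centredInner h u⟩

/-- The pairing in the definition of `Represents` is an inner product of `L²(μ)`. -/
lemma integral_mul_inner_eq {μ : Measure X} [IsProbabilityMeasure μ] (h : MemLp id 2 μ)
    (f : Lp ℝ 2 μ) (u : X) :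
    ∫ z, f z * inner ℝ u (z - ∫ z', z' ∂μ) ∂μ = inner ℝ f (centredInner h u) := by
  rw [L2.inner_def]
  refine integral_congr_ae ?_
  filter_upwards [coeFn_centredInner h u] with z hz
  simp [hz, mul_comm]

lemma compMeasurePreserving_centredInner {x : Ω → X} (hx : MeasurePreserving x P (P.map x))
    [IsProbabilityMeasure (P.map x)]
    (h : MemLp id 2 (P.map x)) (hxm : MemLp x 2 P) (u : X) :
    Lp.compMeasurePreserving x hx (centredInner h u) = centredInner hxm u := by
  refine Lp.ext ?_
  have hmean : ∫ z, id z ∂(P.map x) = ∫ ω, x ω ∂P := by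
    rw [integral_map hx.aemeasurable h.aestronglyMeasurable]
    rfl
  filter_upwards [Lp.coeFn_compMeasurePreserving (centredInner h u) hx,
    hx.quasiMeasurePreserving.ae (coeFn_centredInner h u), coeFn_centredInner hxm u]
    with ω h1 h2 h3
  rw [h1, h3, Function.comp_apply, h2, hmean, id]

variable [CompleteSpace X]

/-- The cross-covariances `C_{xb} v` lie in the Cameron-Martin space of the law of `x`: the
function attached to `C_{xb} v` is the orthogonal projection of `⟪v, b - E b⟫` on the Gaussian
Hilbert space of `x`. -/
lemma exists_represents_crossCov {x : Ω → X} (hx : MeasurePreserving x P (P.map x))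
    [IsProbabilityMeasure (P.map x)]
    (h : MemLp id 2 (P.map x)) (hxm : MemLp x 2 P) {b : Ω → F} (hb : MemLp b 2 P) (v : F) :
    ∃ f, Represents (P.map x) (crossCov P x b v) f := by
  set K := (LinearMap.range (centredInner h)).topologicalClosure
  have : CompleteSpace K := (Submodule.isClosed_topologicalClosure _).completeSpace_coe
  let T : Lp ℝ 2 (P.map x) →L[ℝ] Lp ℝ 2 P :=
    (Lp.compMeasurePreservingₗᵢ ℝ x hx).toContinuousLinearMap
  let g := T.adjoint (centredInner hb v)
  refine ⟨K.starProjection g, ?_, fun u => ?_⟩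
  · rw [gaussianHilbert_eq h]
    exact K.starProjection_apply_mem g
  · rw [integral_mul_inner_eq h]
    have hu : centredInner h u ∈ K := Submodule.le_topologicalClosure _ ⟨u, rfl⟩
    rw [Submodule.inner_starProjection_left_eq_right, Submodule.starProjection_eq_self_iff.2 hu,
      ContinuousLinearMap.adjoint_inner_left, ← inner_centredInner hxm hb]
    congr 1
    exact compMeasurePreserving_centredInner hx h hxm u

end PaleyWiener

section Conditioning

variable {Ω : Type*} [MeasurableSpace Ω] {P : Measure Ω} [IsProbabilityMeasure P]
  {X : Type*} [NormedAddCommGroup X] [InnerProductSpace ℝ X] [CompleteSpace X]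
  [MeasurableSpace X] {J : ℕ}

/-- The function `z ↦ ⟪C_x⁻¹ C_{xb} t, z - E x⟫`, defined by linearity from its values at the
standard basis vectors. -/
noncomputable def regression (P : Measure Ω) (x : Ω → X) (b : Ω → EuclideanSpace ℝ (Fin J))
    (t : EuclideanSpace ℝ (Fin J)) : Lp ℝ 2 (P.map x) :=
  ∑ j, t j • invCovInner (P.map x) (crossCov P x b (EuclideanSpace.single j 1))

omit [IsProbabilityMeasure P] [CompleteSpace X] in
lemma dotProduct_gainMatrix_mulVec (x : Ω → X) (b : Ω → EuclideanSpace ℝ (Fin J))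
    (t : EuclideanSpace ℝ (Fin J)) :
    t.ofLp ⬝ᵥ (gainMatrix P x b).mulVec t.ofLp = ‖regression P x b t‖ ^ 2 := by
  rw [← real_inner_self_eq_norm_sq, regression]
  simp only [dotProduct, Matrix.mulVec, gainMatrix, Matrix.of_apply, sum_inner, inner_sum,
    real_inner_smul_left, real_inner_smul_right, Finset.mul_sum]
  refine Finset.sum_congr rfl fun i _ => Finset.sum_congr rfl fun j _ => ?_
  rw [real_inner_comm (invCovInner (P.map x) (crossCov P x b (EuclideanSpace.single i 1)))]
  ring

section Regression

variable {x : Ω → X} (hx : MeasurePreserving x P (P.map x)) [IsProbabilityMeasure (P.map x)]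
  (h : MemLp id 2 (P.map x)) (hxm : MemLp x 2 P) {b : Ω → EuclideanSpace ℝ (Fin J)}
  (hb : MemLp b 2 P) (t : EuclideanSpace ℝ (Fin J))

include hx h hxm hb

lemma represents_invCovInner (j : Fin J) :
    Represents (P.map x) (crossCov P x b (EuclideanSpace.single j 1))
      (invCovInner (P.map x) (crossCov P x b (EuclideanSpace.single j 1))) := by
  have H := exists_represents_crossCov hx h hxm hb (EuclideanSpace.single j 1)
  rw [invCovInner, dif_pos H]
  exact H.choose_spec

lemma regression_mem_gaussianHilbert : regression P x b t ∈ gaussianHilbert (P.map x) := by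
  have H := fun j => (represents_invCovInner hx h hxm hb j).1
  rw [gaussianHilbert_eq h] at H ⊢
  exact Submodule.sum_mem _ fun j _ => Submodule.smul_mem _ _ (H j)

/-- The residual `⟪t, b - E b⟫ - regression t (x)` is orthogonal to the Gaussian Hilbert space
of `x`. -/
lemma inner_centredInner_compMeasurePreserving {g : Lp ℝ 2 (P.map x)}
    (hg : g ∈ gaussianHilbert (P.map x)) :
    inner ℝ (centredInner hb t) (Lp.compMeasurePreserving x hx g)
      = inner ℝ (regression P x b t) g := by
  have hc : Continuous (Lp.compMeasurePreserving (E := ℝ) (p := 2) x hx) :=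
    (Lp.isometry_compMeasurePreserving hx).continuous
  have hcl : IsClosed {g : Lp ℝ 2 (P.map x) |
      inner ℝ (centredInner hb t) (Lp.compMeasurePreserving x hx g)
        = inner ℝ (regression P x b t) g} :=
    isClosed_eq (by fun_prop) (by fun_prop)
  refine closure_minimal ?_ hcl hg
  rintro g ⟨u, hu⟩
  obtain rfl : g = centredInner h u := Lp.ext (hu.trans (coeFn_centredInner h u).symm)
  rw [Set.mem_ofPred_eq, compMeasurePreserving_centredInner hx h hxm, centredInner_eq_sum,
    regression, sum_inner, sum_inner]
  refine Finset.sum_congr rfl fun j _ => ?_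
  rw [real_inner_smul_left, real_inner_smul_left, inner_centredInner hxm hb,
    ← integral_mul_inner_eq h, (represents_invCovInner hx h hxm hb j).2 u]

/-- The residual of the linear regression of `⟪t, b⟫` on `x` has variance
`⟪t, (C_b - C_{bx} C_x⁻¹ C_{xb}) t⟫`, and its square norm adds to that of any element of the
Gaussian Hilbert space of `x`. -/
lemma norm_sq_residual_add {g : Lp ℝ 2 (P.map x)} (hg : g ∈ gaussianHilbert (P.map x)) :
    ‖centredInner hb t + Lp.compMeasurePreserving x hx (g - regression P x b t)‖ ^ 2
      = t.ofLp ⬝ᵥ (covMatrix P b - gainMatrix P x b).mulVec t.ofLp + ‖g‖ ^ 2 := by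
  have hr := regression_mem_gaussianHilbert hx h hxm hb t
  have hgr : g - regression P x b t ∈ gaussianHilbert (P.map x) := by
    rw [gaussianHilbert_eq h] at hg hr ⊢
    exact Submodule.sub_mem _ hg hr
  rw [norm_add_sq_real, inner_centredInner_compMeasurePreserving hx h hxm hb t hgr,
    Lp.norm_compMeasurePreserving, Matrix.sub_mulVec, dotProduct_sub,
    dotProduct_covMatrix_mulVec hb, dotProduct_gainMatrix_mulVec, norm_sub_sq_real,
    inner_sub_right, real_inner_self_eq_norm_sq, real_inner_comm]
  ring

lemma posSemidef_covMatrix_sub_gainMatrix :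
    (covMatrix P b - gainMatrix P x b).PosSemidef := by
  have h1 : (gainMatrix P x b).IsHermitian := by
    ext i j
    simp [gainMatrix, real_inner_comm]
  refine Matrix.PosSemidef.of_dotProduct_mulVec_nonneg
    ((posSemidef_covMatrix hb).isHermitian.sub h1) fun t => ?_
  have h0 : (0 : Lp ℝ 2 (P.map x)) ∈ gaussianHilbert (P.map x) := by
    rw [gaussianHilbert_eq h]
    exact Submodule.zero_mem _
  have := norm_sq_residual_add hx h hxm hb (WithLp.toLp 2 t) h0
  rw [norm_zero, zero_pow two_ne_zero, add_zero] at this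
  simp only [star_trivial]
  rw [← this]
  positivity

omit [CompleteSpace X] in
lemma coeFn_residual_add (u : X) :
    ⇑(centredInner hb t + Lp.compMeasurePreserving x hx (centredInner h u - regression P x b t))
      =ᵐ[P] fun ω => inner ℝ u (x ω - ∫ ω', x ω' ∂P)
        + inner ℝ t (b ω - nuBar P x b (x ω)) := by
  have hreg : ⇑(regression P x b t) =ᵐ[P.map x] fun z => ∑ j, t j *
      invCovInner (P.map x) (crossCov P x b (EuclideanSpace.single j 1)) z := by
    rw [regression]
    refine (Lp.coeFn_finsetSum _ _).trans ?_
    have : ∀ᵐ z ∂(P.map x), ∀ j, (t j • invCovInner (P.map x)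
        (crossCov P x b (EuclideanSpace.single j 1)) : Lp ℝ 2 (P.map x)) z
          = t j * invCovInner (P.map x) (crossCov P x b (EuclideanSpace.single j 1)) z :=
      ae_all_iff.2 fun j => Lp.coeFn_smul _ _
    filter_upwards [this] with z hz
    simp [Finset.sum_apply, hz]
  rw [map_sub, compMeasurePreserving_centredInner hx h hxm]
  filter_upwards [Lp.coeFn_add (centredInner hb t)
      (centredInner hxm u - Lp.compMeasurePreserving x hx (regression P x b t)),
    Lp.coeFn_sub (centredInner hxm u) (Lp.compMeasurePreserving x hx (regression P x b t)),
    Lp.coeFn_compMeasurePreserving (regression P x b t) hx,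
    hx.quasiMeasurePreserving.ae hreg, coeFn_centredInner hb t, coeFn_centredInner hxm u]
    with ω h1 h2 h3 h4 h5 h6
  rw [h1, Pi.add_apply, h2, Pi.sub_apply, h3, Function.comp_apply, h4, h5, h6, nuBar,
    sub_add_eq_sub_sub, inner_sub_right t (b ω - _)]
  have h7 : ∀ w : Fin J → ℝ, inner ℝ t (WithLp.toLp 2 w) = ∑ j, t j * w j := fun w => by
    simp [PiLp.inner_apply, mul_comm]
  rw [h7 fun j => invCovInner (P.map x) (crossCov P x b (EuclideanSpace.single j 1)) (x ω)]
  ring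

end Regression

omit [IsProbabilityMeasure P] [CompleteSpace X] in
lemma measurable_nuBar (x : Ω → X) (b : Ω → EuclideanSpace ℝ (Fin J)) :
    Measurable (nuBar P x b) := by
  unfold nuBar
  refine measurable_const.add ((PiLp.continuous_toLp 2 _).measurable.comp ?_)
  exact measurable_pi_lambda _ fun j => (Lp.stronglyMeasurable _).measurable

variable [BorelSpace X] [SecondCountableTopology X]

/-- For jointly Gaussian `(b, x)`, the sum of `⟪t, b - E b⟫` and an element of the Gaussian Hilbert
space of `x` is an `L²` limit of centred Gaussian variables, so it has the Gaussian characteristic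
function. -/
lemma add_compMeasurePreserving_mem_gaussianCharSet {x : Ω → X}
    {b : Ω → EuclideanSpace ℝ (Fin J)} (hbx : HasGaussianLaw (fun ω => (b ω, x ω)) P)
    (hx : MeasurePreserving x P (P.map x)) (hb : MemLp b 2 P) (t : EuclideanSpace ℝ (Fin J))
    {g : Lp ℝ 2 (P.map x)} (hg : g ∈ gaussianHilbert (P.map x)) :
    centredInner hb t + Lp.compMeasurePreserving x hx g ∈ gaussianCharSet P := by
  have hxG := hbx.snd
  have := hxG.isGaussian_map
  have h : MemLp id 2 (P.map x) := IsGaussian.memLp_two_id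
  have hxm := hxG.memLp_two
  have hc : Continuous (Lp.compMeasurePreserving (E := ℝ) (p := 2) x hx) :=
    (Lp.isometry_compMeasurePreserving hx).continuous
  have hcl : IsClosed {g : Lp ℝ 2 (P.map x) |
      centredInner hb t + Lp.compMeasurePreserving x hx g ∈ gaussianCharSet P} :=
    isClosed_gaussianCharSet.preimage (by fun_prop)
  refine closure_minimal ?_ hcl hg
  rintro g ⟨u, hu⟩
  obtain rfl : g = centredInner h u := Lp.ext (hu.trans (coeFn_centredInner h u).symm)
  rw [Set.mem_ofPred_eq, compMeasurePreserving_centredInner hx h hxm]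
  set L : StrongDual ℝ (EuclideanSpace ℝ (Fin J) × X) :=
    (innerSL ℝ t).coprod (innerSL ℝ u) with hL
  have hLG : HasGaussianLaw (fun ω => L (b ω, x ω)) P := hbx.map_fun L
  set m : ℝ := ∫ ω, L (b ω, x ω) ∂P with hm
  have hsub : HasGaussianLaw (fun ω => L (b ω, x ω) - m) P := by
    have := hLG.isGaussian_map
    constructor
    have h2 : P.map (fun ω => L (b ω, x ω) - m)
        = (P.map (fun ω => L (b ω, x ω))).map (fun r => r - m) := by
      rw [AEMeasurable.map_map_of_aemeasurable (by fun_prop) hLG.aemeasurable]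
      rfl
    rw [h2]
    infer_instance
  have h0 : ∫ ω, (L (b ω, x ω) - m) ∂P = 0 := by
    rw [integral_sub hLG.integrable (integrable_const _), ← hm]
    simp
  have hmem := toLp_mem_gaussianCharSet hsub h0 hsub.memLp_two
  convert! hmem using 1
  refine Lp.ext ?_
  filter_upwards [Lp.coeFn_add (centredInner hb t) (centredInner hxm u),
    coeFn_centredInner hb t, coeFn_centredInner hxm u, hsub.memLp_two.coeFn_toLp]
    with ω h1 h2 h3 h4
  have hmv : m = inner ℝ t (∫ ω, b ω ∂P) + inner ℝ u (∫ ω, x ω ∂P) := by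
    have hbi := hbx.fst.integrable
    have hxi := hxG.integrable
    rw [hm, ← integral_inner hbi, ← integral_inner hxi,
      ← integral_add (hbi.const_inner t) (hxi.const_inner u)]
    simp [hL]
  rw [h1, Pi.add_apply, h2, h3, h4, hmv, hL]
  simp only [ContinuousLinearMap.coprod_apply, innerSL_apply_apply, inner_sub_right]
  ring

/-- **Gaussian conditioning.** If `(b, x)` is jointly Gaussian, then the residual
`b - E[b | x]` is independent of `x`, with law `N(0, C_b - C_{bx} C_x⁻¹ C_{xb})`. -/
theorem map_residual_eq_prod {x : Ω → X} {b : Ω → EuclideanSpace ℝ (Fin J)}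
    (hbx : HasGaussianLaw (fun ω => (b ω, x ω)) P) (hxmeas : Measurable x) :
    P.map (fun ω => (x ω, b ω - nuBar P x b (x ω)))
      = (P.map x).prod (multivariateGaussian 0 (covMatrix P b - gainMatrix P x b)) := by
  have hx : MeasurePreserving x P (P.map x) := hxmeas.measurePreserving P
  have hxG := hbx.snd
  have := hxG.isGaussian_map
  have h : MemLp id 2 (P.map x) := IsGaussian.memLp_two_id
  have hxm := hxG.memLp_two
  have hb := hbx.fst.memLp_two
  have hbm := hbx.fst.aemeasurable
  have hnu := measurable_nuBar (P := P) x b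
  have hres : AEMeasurable (fun ω => (x ω, b ω - nuBar P x b (x ω))) P :=
    hxmeas.aemeasurable.prodMk (hbm.sub (hnu.comp hxmeas).aemeasurable)
  have : IsProbabilityMeasure (P.map (fun ω => (x ω, b ω - nuBar P x b (x ω)))) :=
    Measure.isProbabilityMeasure_map hres
  refine charFun_eq_prod_iff.1 fun t => ?_
  obtain ⟨u, t⟩ := t
  simp only
  -- the characteristic function of the centred pair, which factorises
  have key : ∀ s : EuclideanSpace ℝ (Fin J),
      ∫ ω, Complex.exp ((inner ℝ u (x ω - ∫ ω', x ω' ∂P)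
        + inner ℝ s (b ω - nuBar P x b (x ω)) : ℝ) * Complex.I) ∂P
      = Complex.exp (-((s.ofLp ⬝ᵥ (covMatrix P b - gainMatrix P x b).mulVec s.ofLp
        + ‖centredInner h u‖ ^ 2) / 2 : ℝ)) := by
    intro s
    have hu : centredInner h u ∈ gaussianHilbert (P.map x) :=
      subset_closure ⟨u, coeFn_centredInner h u⟩
    have hr := regression_mem_gaussianHilbert hx h hxm hb s
    have hgr : centredInner h u - regression P x b s ∈ gaussianHilbert (P.map x) := by
      rw [gaussianHilbert_eq h] at hu hr ⊢
      exact Submodule.sub_mem _ hu hr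
    have hmem := add_compMeasurePreserving_mem_gaussianCharSet hbx hx hb s hgr
    rw [gaussianCharSet, Set.mem_ofPred_eq, norm_sq_residual_add hx h hxm hb s hu] at hmem
    rw [← hmem]
    refine integral_congr_ae ?_
    filter_upwards [coeFn_residual_add hx h hxm hb s u] with ω hω
    rw [hω]
  set m : ℝ := inner ℝ u (∫ ω', x ω' ∂P) with hm
  have hchar : charFun (P.map x) u = Complex.exp (m * Complex.I)
      * Complex.exp (-(‖centredInner h u‖ ^ 2 / 2 : ℝ)) := by
    have h1 := key 0
    simp only [inner_zero_left, add_zero, WithLp.ofLp_zero, zero_dotProduct, zero_add] at h1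
    rw [← h1, charFun_apply, integral_map hxmeas.aemeasurable (by fun_prop),
      ← integral_const_mul]
    refine integral_congr_ae (ae_of_all _ fun ω => ?_)
    simp only
    rw [← Complex.exp_add, ← add_mul, ← Complex.ofReal_add, inner_sub_right, hm,
      real_inner_comm]
    congr 3
    ring
  rw [charFun_multivariateGaussian (posSemidef_covMatrix_sub_gainMatrix hx h hxm hb), hchar,
    AEMeasurable.map_map_of_aemeasurable (by fun_prop) hres, charFun_apply,
    integral_map (by fun_prop) (by fun_prop)]
  have h2 := key t
  have h3 : ∀ ω, Complex.exp ((inner ℝ ((WithLp.toLp 2 ∘ fun ω => (x ω, b ω - nuBar P x b (x ω))) ω)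
      (WithLp.toLp 2 (u, t)) : ℝ) * Complex.I) = Complex.exp (m * Complex.I) *
      Complex.exp ((inner ℝ u (x ω - ∫ ω', x ω' ∂P)
        + inner ℝ t (b ω - nuBar P x b (x ω)) : ℝ) * Complex.I) := by
    intro ω
    rw [← Complex.exp_add, ← add_mul, ← Complex.ofReal_add]
    congr 3
    rw [Function.comp_apply, WithLp.prod_inner_apply, inner_sub_right u, hm,
      real_inner_comm u, real_inner_comm t]
    ring
  simp_rw [h3]
  rw [integral_const_mul, h2, mul_assoc, ← Complex.exp_add, ← Complex.exp_add,
    ← Complex.exp_add]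
  congr 1
  rw [inner_zero_right]
  push_cast
  ring

end Conditioning

/-! ### Absolute continuity of Gaussian measures and the observation model -/

section AbsolutelyContinuous

lemma pi_absolutelyContinuous_pi {n : ℕ} (μ ν : Measure ℝ) [SigmaFinite μ] [SigmaFinite ν]
    (h : μ ≪ ν) : Measure.pi (fun _ : Fin n => μ) ≪ Measure.pi (fun _ : Fin n => ν) := by
  induction n with
  | zero => rw [Measure.pi_of_empty, Measure.pi_of_empty]
  | succ n ih =>
    have h1 := (measurePreserving_piFinSuccAbove (fun _ : Fin (n + 1) => μ) 0).symm
    have h2 := (measurePreserving_piFinSuccAbove (fun _ : Fin (n + 1) => ν) 0).symm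
    rw [← h1.map_eq, ← h2.map_eq]
    exact (h.prod ih).map (MeasurableEquiv.measurable _)

lemma stdGaussian_absolutelyContinuous_volume {J : ℕ} :
    stdGaussian (EuclideanSpace ℝ (Fin J)) ≪ volume := by
  rw [← map_pi_eq_stdGaussian, ← (PiLp.volume_preserving_toLp (Fin J)).map_eq]
  exact (pi_absolutelyContinuous_pi _ _
    (gaussianReal_absolutelyContinuous 0 one_ne_zero)).map (by fun_prop)

lemma volume_absolutelyContinuous_stdGaussian {J : ℕ} :
    volume ≪ stdGaussian (EuclideanSpace ℝ (Fin J)) := by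
  rw [← map_pi_eq_stdGaussian, ← (PiLp.volume_preserving_toLp (Fin J)).map_eq]
  exact (pi_absolutelyContinuous_pi _ _
    (gaussianReal_absolutelyContinuous' 0 one_ne_zero)).map (by fun_prop)

/-- Symmetric maps with equal ranges differ by an invertible factor on the right. -/
lemma exists_det_ne_zero_comp_eq {E : Type*} [NormedAddCommGroup E] [InnerProductSpace ℝ E]
    [FiniteDimensional ℝ E] {A B : E →ₗ[ℝ] E} (hA : A.IsSymmetric) (hB : B.IsSymmetric)
    (h : LinearMap.range A = LinearMap.range B) :
    ∃ C : E →ₗ[ℝ] E, LinearMap.det C ≠ 0 ∧ B ∘ₗ C = A := by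
  have hker : LinearMap.ker A = LinearMap.ker B := by
    rw [← hA.orthogonal_range, ← hB.orthogonal_range, h]
  obtain ⟨C₀, hC₀⟩ := Module.projective_lifting_property B.rangeRestrict
    (A.codRestrict (LinearMap.range B) fun x => h ▸ LinearMap.mem_range_self A x)
    B.surjective_rangeRestrict
  have hBC : ∀ x, B (C₀ x) = A x := fun x => congrArg Subtype.val (LinearMap.congr_fun hC₀ x)
  set K := LinearMap.ker B
  have hBK : ∀ x, B (K.starProjection x) = 0 := fun x => K.starProjection_apply_mem x
  -- a lift of `A` through `B`, corrected on the common kernel `K` to be injective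
  let C : E →ₗ[ℝ] E := C₀ - K.starProjection.toLinearMap ∘ₗ C₀ + K.starProjection.toLinearMap
  have hC : ∀ x, C x = (C₀ x - K.starProjection (C₀ x)) + K.starProjection x := fun x => rfl
  have hBCx : ∀ x, B (C x) = A x := fun x => by
    rw [hC, map_add, map_sub, hBK, hBK, hBC, sub_zero, add_zero]
  refine ⟨C, ?_, LinearMap.ext hBCx⟩
  have hinj : LinearMap.ker C = ⊥ := by
    rw [LinearMap.ker_eq_bot']
    intro x hx
    have hxK : x ∈ K := by
      rw [← hker, LinearMap.mem_ker, ← hBCx, hx, map_zero]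
    have h1 : K.starProjection x = x := Submodule.starProjection_eq_self_iff.2 hxK
    have h2 : C₀ x - K.starProjection (C₀ x) = -x := by
      rw [eq_neg_iff_add_eq_zero, ← h1, ← hx, hC, h1]
    have h3 : -x ∈ Kᗮ := h2 ▸ K.sub_starProjection_mem_orthogonal (C₀ x)
    have h4 : inner ℝ x (-x) = 0 := h3 x hxK
    rwa [inner_neg_right, neg_eq_zero, inner_self_eq_zero] at h4
  exact LinearMap.isUnit_det C ((LinearMap.isUnit_iff_ker_eq_bot C).2 hinj) |>.ne_zero

/-- The finite-dimensional Cameron-Martin and Feldman-Hájek theorem (absolute continuity part). -/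
theorem multivariateGaussian_absolutelyContinuous {J : ℕ} {S₀ S₁ : Matrix (Fin J) (Fin J) ℝ}
    {m : EuclideanSpace ℝ (Fin J)} (h : rangeSqrt S₀ = rangeSqrt S₁) (hm : m ∈ rangeSqrt S₀) :
    multivariateGaussian m S₁ ≪ multivariateGaussian 0 S₀ := by
  have hsymm : ∀ S : Matrix (Fin J) (Fin J) ℝ,
      (Matrix.toEuclideanLin (CFC.sqrt S)).IsSymmetric := fun S =>
    Matrix.isSymmetric_toEuclideanLin_iff.2 (CFC.sqrt_nonneg S).isSelfAdjoint
  obtain ⟨C, hC, hBC⟩ := exists_det_ne_zero_comp_eq (hsymm S₁) (hsymm S₀) h.symm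
  obtain ⟨w, hw⟩ := hm
  have hf : (fun v => m + Matrix.toEuclideanCLM (𝕜 := ℝ) (CFC.sqrt S₁) v)
      = (fun v => (0 : EuclideanSpace ℝ (Fin J)) + Matrix.toEuclideanCLM (𝕜 := ℝ)
        (CFC.sqrt S₀) v) ∘ fun v => w + C v := by
    ext1 v
    have h1 : Matrix.toEuclideanLin (CFC.sqrt S₁) v
      = Matrix.toEuclideanLin (CFC.sqrt S₀) (C v) := (LinearMap.congr_fun hBC v).symm
    change m + Matrix.toEuclideanLin (CFC.sqrt S₁) v
      = 0 + Matrix.toEuclideanLin (CFC.sqrt S₀) (w + C v)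
    rw [h1, map_add, hw, zero_add]
  have hCm : Measurable C := C.continuous_of_finiteDimensional.measurable
  rw [multivariateGaussian, multivariateGaussian, hf,
    ← Measure.map_map (by fun_prop) (by fun_prop)]
  refine Measure.AbsolutelyContinuous.map ?_ (by fun_prop)
  have h2 : (volume : Measure (EuclideanSpace ℝ (Fin J))).map (fun v => w + C v) ≪ volume := by
    have : (fun v => w + C v) = (fun v => w + v) ∘ C := rfl
    rw [this, ← Measure.map_map (by fun_prop) hCm,
      Measure.map_linearMap_addHaar_eq_smul_addHaar _ hC, Measure.map_smul,
      map_add_left_eq_self]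
    exact Measure.smul_absolutelyContinuous
  exact ((stdGaussian_absolutelyContinuous_volume.map (by fun_prop)).trans h2).trans
    volume_absolutelyContinuous_stdGaussian

end AbsolutelyContinuous

section Model

variable {Ω : Type*} [MeasurableSpace Ω] {P : Measure Ω} [IsProbabilityMeasure P]
  {X : Type*} [NormedAddCommGroup X] [InnerProductSpace ℝ X] [CompleteSpace X]
  [MeasurableSpace X] [BorelSpace X] [SecondCountableTopology X] {J : ℕ}

/-- A centred Gaussian vector has the law `N(0, C)`, with `C` its covariance matrix. -/
lemma map_eq_multivariateGaussian {b : Ω → EuclideanSpace ℝ (Fin J)} (hb : HasGaussianLaw b P)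
    (h0 : ∫ ω, b ω ∂P = 0) : P.map b = multivariateGaussian 0 (covMatrix P b) := by
  have hb2 := hb.memLp_two
  have := hb.isGaussian_map
  refine Measure.ext_of_charFun (funext fun t => ?_)
  rw [charFun_multivariateGaussian (posSemidef_covMatrix hb2), hb.charFun_map_eq,
    dotProduct_covMatrix_mulVec hb2, integral_inner hb.integrable, h0, inner_zero_right]
  have h1 : ∫ ω, inner ℝ t (b ω) ∂P = 0 := by
    rw [integral_inner hb.integrable, h0, inner_zero_right]
  have h2 : Var[fun ω => inner ℝ t (b ω); P] = ‖centredInner hb2 t‖ ^ 2 := by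
    rw [variance_of_integral_eq_zero (hb2.const_inner t).aemeasurable h1,
      ← real_inner_self_eq_norm_sq, L2.inner_def]
    refine integral_congr_ae ?_
    filter_upwards [coeFn_centredInner hb2 t] with ω hω
    simp [hω, h0, sq]
  rw [h2]

lemma centredInner_fun_add {E : Type*} [NormedAddCommGroup E] [InnerProductSpace ℝ E]
    [CompleteSpace E]
    {a b : Ω → E} (ha : MemLp a 2 P) (hb : MemLp b 2 P)
    (hab : MemLp (fun ω => a ω + b ω) 2 P) (u : E) :
    centredInner hab u = centredInner ha u + centredInner hb u := by
  refine Lp.ext ?_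
  filter_upwards [Lp.coeFn_add (centredInner ha u) (centredInner hb u), coeFn_centredInner ha u,
    coeFn_centredInner hb u, coeFn_centredInner hab u] with ω h1 h2 h3 h4
  rw [h1, h4, Pi.add_apply, h2, h3, ← inner_add_right,
    integral_add (ha.integrable (by norm_num)) (hb.integrable (by norm_num))]
  congr 1
  abel

/-- Independent random variables are uncorrelated. -/
lemma inner_centredInner_eq_zero {E F : Type*} [NormedAddCommGroup E] [InnerProductSpace ℝ E]
    [CompleteSpace E] [MeasurableSpace E] [BorelSpace E] [NormedAddCommGroup F]
    [InnerProductSpace ℝ F] [MeasurableSpace F] [BorelSpace F]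
    {a : Ω → E} {b : Ω → F} (ha : MemLp a 2 P) (hb : MemLp b 2 P) (hind : IndepFun b a P)
    (u : E) (v : F) : inner ℝ (centredInner hb v) (centredInner ha u) = 0 := by
  have h1 : inner ℝ (centredInner hb v) (centredInner ha u)
      = ∫ ω, inner ℝ u (a ω - ∫ ω', a ω' ∂P) * inner ℝ v (b ω - ∫ ω', b ω' ∂P) ∂P := by
    rw [L2.inner_def]
    refine integral_congr_ae ?_
    filter_upwards [coeFn_centredInner ha u, coeFn_centredInner hb v] with ω h1 h2
    simp [h1, h2]
  have hi : IndepFun (fun ω => inner ℝ u (a ω - ∫ ω', a ω' ∂P))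
      (fun ω => inner ℝ v (b ω - ∫ ω', b ω' ∂P)) P :=
    hind.symm.comp (φ := fun z => inner ℝ u (z - ∫ ω', a ω' ∂P))
      (ψ := fun z => inner ℝ v (z - ∫ ω', b ω' ∂P)) (by fun_prop) (by fun_prop)
  have ha1 : Integrable a P := ha.integrable (by norm_num)
  have hd : Integrable (fun ω => a ω - ∫ ω', a ω' ∂P) P := ha1.sub (integrable_const _)
  have h2 : ∫ ω, inner ℝ u (a ω - ∫ ω', a ω' ∂P) ∂P = 0 := by
    rw [integral_inner hd, integral_sub ha1 (integrable_const _)]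
    simp
  rw [h1, hi.integral_fun_mul_eq_mul_integral
    ((ha.sub (memLp_const _)).const_inner u).aestronglyMeasurable
    ((hb.sub (memLp_const _)).const_inner v).aestronglyMeasurable, h2, zero_mul]

variable {x : Ω → X} {ε η : Ω → EuclideanSpace ℝ (Fin J)}

/-- Adding the independent centred noise `η` to `ε` changes neither the cross-covariance with `x`
nor the regression on `x`, and adds the covariances. -/
lemma crossCov_nuBar_covMatrix_add (hεx : HasGaussianLaw (fun ω => (ε ω, x ω)) P)
    (hηG : HasGaussianLaw η P) (hη0 : ∫ ω, η ω ∂P = 0)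
    (hind : IndepFun η (fun ω => (ε ω, x ω)) P)
    (hadd : MemLp (fun ω => ε ω + η ω) 2 P) :
    (∀ v, crossCov P x (fun ω => ε ω + η ω) v = crossCov P x ε v)
      ∧ nuBar P x (fun ω => ε ω + η ω) = nuBar P x ε
      ∧ covMatrix P (fun ω => ε ω + η ω) = covMatrix P η + covMatrix P ε := by
  have hε2 := hεx.fst.memLp_two
  have hx2 := hεx.snd.memLp_two
  have hη2 := hηG.memLp_two
  have hηx : IndepFun η x P := hind.comp measurable_id measurable_snd
  have hηε : IndepFun η ε P := hind.comp measurable_id measurable_fst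
  have hcross : ∀ v, crossCov P x (fun ω => ε ω + η ω) v = crossCov P x ε v := by
    refine fun v => ext_inner_right ℝ fun u => ?_
    rw [← inner_centredInner hx2 hadd, ← inner_centredInner hx2 hε2,
      centredInner_fun_add hε2 hη2, inner_add_left, inner_centredInner_eq_zero hx2 hη2 hηx,
      add_zero]
  refine ⟨hcross, ?_, ?_⟩
  · ext1 z
    simp only [nuBar, hcross]
    rw [integral_add hεx.fst.integrable hηG.integrable, hη0, add_zero]
  · ext i j
    rw [Matrix.add_apply, covMatrix_apply hadd, covMatrix_apply hε2, covMatrix_apply hη2,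
      centredInner_fun_add hε2 hη2, centredInner_fun_add hε2 hη2, inner_add_left,
      inner_add_right, inner_add_right, inner_centredInner_eq_zero hε2 hη2 hηε,
      inner_centredInner_eq_zero hη2 hε2 hηε.symm]
    ring

/-- The joint law of `x` and the residual noise `ε + η - nuBar x`. -/
lemma map_noise_eq_prod (hx : Measurable x) (hεx : HasGaussianLaw (fun ω => (ε ω, x ω)) P)
    (hηG : HasGaussianLaw η P) (hη0 : ∫ ω, η ω ∂P = 0)
    (hind : IndepFun η (fun ω => (ε ω, x ω)) P) :
    P.map (fun ω => (x ω, ε ω + η ω - nuBar P x ε (x ω)))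
      = (P.map x).prod (multivariateGaussian 0 (covNu P x ε η)) := by
  have hsum : HasGaussianLaw (fun ω => (ε ω + η ω, x ω)) P := by
    have h := (IndepFun.hasGaussianLaw hηG hεx hind).map_fun
      (((ContinuousLinearMap.fst ℝ _ _).comp (ContinuousLinearMap.snd ℝ _ _)
        + ContinuousLinearMap.fst ℝ (EuclideanSpace ℝ (Fin J))
          (EuclideanSpace ℝ (Fin J) × X)).prod
        ((ContinuousLinearMap.snd ℝ _ _).comp (ContinuousLinearMap.snd ℝ _ _)))
    simpa using h
  obtain ⟨h1, h2, h3⟩ := crossCov_nuBar_covMatrix_add hεx hηG hη0 hind hsum.fst.memLp_two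
  have h4 : gainMatrix P x (fun ω => ε ω + η ω) = gainMatrix P x ε := by
    simp only [gainMatrix, h1]
  have := map_residual_eq_prod hsum hx
  rwa [h2, h3, h4] at this

omit [IsProbabilityMeasure P] [CompleteSpace X] [BorelSpace X] [SecondCountableTopology X] in
lemma condLaw_eq_map (G : X → EuclideanSpace ℝ (Fin J)) (z : X) :
    condLaw P G x ε η z = (multivariateGaussian 0 (covNu P x ε η)).map
      fun w => G z + nuBar P x ε z + w := by
  rw [condLaw, multivariateGaussian, multivariateGaussian,
    Measure.map_map (by fun_prop) (by fun_prop)]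
  simp [Function.comp_def]

/-- The joint law of `x` and `y = G x + ε + η` disintegrates as `μ₀(dz) condLaw z (dy)`. -/
theorem map_prod_eq_lintegral_condLaw {G : X → EuclideanSpace ℝ (Fin J)} (hG : Measurable G)
    (hx : Measurable x) (hε : Measurable ε) (hη : Measurable η)
    (hεx : HasGaussianLaw (fun ω => (ε ω, x ω)) P)
    (hηG : HasGaussianLaw η P) (hη0 : ∫ ω, η ω ∂P = 0)
    (hind : IndepFun η (fun ω => (ε ω, x ω)) P) {s : Set (X × EuclideanSpace ℝ (Fin J))}
    (hs : MeasurableSet s) :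
    P.map (fun ω => (x ω, G (x ω) + ε ω + η ω)) s
      = ∫⁻ z, condLaw P G x ε η z (Prod.mk z ⁻¹' s) ∂(P.map x) := by
  have hnu := measurable_nuBar (P := P) x ε
  have hT : Measurable fun p : X × EuclideanSpace ℝ (Fin J) =>
    (p.1, G p.1 + nuBar P x ε p.1 + p.2) := by fun_prop
  have h1 : (fun ω => (x ω, G (x ω) + ε ω + η ω))
      = (fun p : X × EuclideanSpace ℝ (Fin J) => (p.1, G p.1 + nuBar P x ε p.1 + p.2))
        ∘ fun ω => (x ω, ε ω + η ω - nuBar P x ε (x ω)) := by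
    ext1 ω
    simp only [Function.comp_apply, Prod.mk.injEq, true_and]
    abel
  rw [h1, ← Measure.map_map hT (by fun_prop), map_noise_eq_prod hx hεx hηG hη0 hind,
    Measure.map_apply hT hs, Measure.prod_apply (hT hs)]
  refine lintegral_congr fun z => ?_
  rw [condLaw_eq_map, Measure.map_apply (by fun_prop) (measurable_prodMk_left hs)]
  rfl

end Model

/-! ### Bayes' formula -/

section Bayes

variable {X Y : Type*} [MeasurableSpace X] [MeasurableSpace Y] {μ₀ : Measure X}
  [IsProbabilityMeasure μ₀] {Q₀ : Measure Y} [IsProbabilityMeasure Q₀]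

omit [IsProbabilityMeasure μ₀] in
lemma eq_withDensity_of_apply_eq_lintegral {ς : Measure (X × Y)} {L : X → Measure Y}
    (hς : ∀ s, MeasurableSet s → ς s = ∫⁻ z, L z (Prod.mk z ⁻¹' s) ∂μ₀)
    {w : X × Y → ℝ≥0∞} (hw : Measurable w)
    (hL : ∀ᵐ z ∂μ₀, L z = Q₀.withDensity fun v => w (z, v)) :
    ς = (μ₀.prod Q₀).withDensity w := by
  ext s hs
  rw [hς s hs, withDensity_apply _ hs, ← lintegral_indicator hs,
    lintegral_prod _ (hw.indicator hs).aemeasurable]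
  refine lintegral_congr_ae ?_
  filter_upwards [hL] with z hz
  rw [hz, withDensity_apply _ (measurable_prodMk_left hs),
    ← lintegral_indicator (measurable_prodMk_left hs)]
  rfl

/-- **Bayes' formula** for a density `D(z, v) a(v)` with respect to `μ₀ ⊗ Q₀`: the conditional law
of the first variable given the second has density `D(·, v) / ∫ D(z, v) μ₀(dz)`. -/
lemma exists_kernel_of_withDensity {D : X → Y → ℝ≥0∞} (hD : Measurable (Function.uncurry D))
    {a : Y → ℝ≥0∞} (ha : Measurable a) (ha0 : ∀ v, a v ≠ 0)
    {ς : Measure (X × Y)} [IsProbabilityMeasure ς]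
    (hς : ς = (μ₀.prod Q₀).withDensity fun p => D p.1 p.2 * a p.2)
    (hZ : ∀ᵐ v ∂Q₀, 0 < ∫⁻ z, D z v ∂μ₀) :
    ∃ κ : Kernel Y X, IsMarkovKernel κ ∧ ς.map Prod.swap = ς.snd ⊗ₘ κ ∧ ς.snd ≪ Q₀ ∧
      ∀ᵐ v ∂Q₀, ∫⁻ z, D z v ∂μ₀ < ∞ ∧
        κ v = μ₀.withDensity fun z => D z v / ∫⁻ z, D z v ∂μ₀ := by
  set Z : Y → ℝ≥0∞ := fun v => ∫⁻ z, D z v ∂μ₀ with hZdef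
  have hDs : Measurable fun p : Y × X => D p.2 p.1 := hD.comp measurable_swap
  have hZm : Measurable Z := hDs.lintegral_prod_right'
  have hDv : ∀ v, Measurable fun z => D z v := fun v => hDs.comp measurable_prodMk_left
  have hw : Measurable fun p : X × Y => D p.1 p.2 * a p.2 := hD.mul (ha.comp measurable_snd)
  -- the joint law, integrating over the first variable first
  have happly : ∀ s : Set (Y × X), MeasurableSet s → ς.map Prod.swap s
      = ∫⁻ v, (∫⁻ z in Prod.mk v ⁻¹' s, D z v ∂μ₀) * a v ∂Q₀ := by
    intro s hs
    rw [Measure.map_apply measurable_swap hs, hς, withDensity_apply _ (measurable_swap hs),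
      ← lintegral_indicator (measurable_swap hs),
      lintegral_prod_symm _ (hw.indicator (measurable_swap hs)).aemeasurable]
    refine lintegral_congr fun v => ?_
    rw [← lintegral_mul_const _ (hDv v), ← lintegral_indicator (measurable_prodMk_left hs)]
    rfl
  have hsnd : ς.snd = Q₀.withDensity fun v => Z v * a v := by
    ext t ht
    have h1 : ς.snd t = ς.map Prod.swap (t ×ˢ Set.univ) := by
      rw [Measure.snd_apply ht, Measure.map_apply measurable_swap (ht.prod MeasurableSet.univ)]
      congr 1
      ext p
      simp
    rw [h1, happly _ (ht.prod MeasurableSet.univ), withDensity_apply _ ht,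
      ← lintegral_indicator ht]
    refine lintegral_congr fun v => ?_
    by_cases hv : v ∈ t
    · simp [hv, hZdef]
    · simp [hv]
  have hfin : ∀ᵐ v ∂Q₀, Z v < ∞ := by
    have h1 : ∫⁻ v, Z v * a v ∂Q₀ ≠ ∞ := by
      have h2 : ς.snd Set.univ = ∫⁻ v, Z v * a v ∂Q₀ := by
        rw [hsnd, withDensity_apply _ MeasurableSet.univ, Measure.restrict_univ]
      rw [← h2]
      exact measure_ne_top _ _
    filter_upwards [ae_lt_top (hZm.mul ha) h1] with v hv
    by_contra htop
    rw [not_lt, top_le_iff] at htop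
    rw [Pi.mul_apply, htop, ENNReal.top_mul (ha0 v)] at hv
    exact lt_irrefl _ hv
  have hg : MeasurableSet {v | 0 < Z v ∧ Z v < ∞} :=
    (measurableSet_lt measurable_const hZm).inter (measurableSet_lt hZm measurable_const)
  have hdens : Measurable (Function.uncurry fun v z => D z v / Z v) :=
    hDs.div (hZm.comp measurable_fst)
  classical
  let κ : Kernel Y X := Kernel.piecewise hg
    (Kernel.withDensity (Kernel.const Y μ₀) fun v z => D z v / Z v) (Kernel.const Y μ₀)
  have hκ : ∀ v, 0 < Z v → Z v < ∞ → κ v = μ₀.withDensity fun z => D z v / Z v := by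
    intro v h0 h1
    rw [Kernel.piecewise_apply, if_pos ⟨h0, h1⟩, Kernel.withDensity_apply _ hdens,
      Kernel.const_apply]
  have hmarkov : IsMarkovKernel κ := by
    refine ⟨fun v => ?_⟩
    by_cases hv : v ∈ {v | 0 < Z v ∧ Z v < ∞}
    · rw [hκ v hv.1 hv.2]
      refine ⟨?_⟩
      rw [withDensity_apply _ MeasurableSet.univ, Measure.restrict_univ]
      simp_rw [div_eq_mul_inv]
      rw [lintegral_mul_const _ (hDv v)]
      exact ENNReal.mul_inv_cancel hv.1.ne' hv.2.ne
    · rw [Kernel.piecewise_apply, if_neg hv, Kernel.const_apply]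
      infer_instance
  refine ⟨κ, hmarkov, ?_, ?_, ?_⟩
  · ext s hs
    have hZa : Measurable fun v => Z v * a v := hZm.mul ha
    rw [happly s hs, Measure.compProd_apply hs, hsnd,
      lintegral_withDensity_eq_lintegral_mul _ hZa
        (Kernel.measurable_kernel_prodMk_left hs)]
    refine lintegral_congr_ae ?_
    filter_upwards [hZ, hfin] with v h0 h1
    rw [Pi.mul_apply, hκ v h0 h1, withDensity_apply _ (measurable_prodMk_left hs)]
    simp_rw [div_eq_mul_inv]
    rw [lintegral_mul_const _ (hDv v), mul_comm (Z v * a v), mul_assoc, ← mul_assoc _ (Z v),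
      ENNReal.inv_mul_cancel h0.ne' h1.ne, one_mul]
  · rw [hsnd]
    exact withDensity_absolutelyContinuous _ _
  · filter_upwards [hZ, hfin] with v h0 h1
    exact ⟨h1, hκ v h0 h1⟩

/-- Bayes' formula for an almost everywhere measurable potential. -/
theorem exists_kernel_posteriorDensity {Φ : X → Y → ℝ}
    (hΦm : AEMeasurable (fun p : X × Y => Φ p.1 p.2) (μ₀.prod Q₀)) {c : Y → ℝ}
    (hc : Measurable c) (hc0 : ∀ v, 0 < c v) {ς : Measure (X × Y)} [IsProbabilityMeasure ς]
    {L : X → Measure Y}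
    (hς : ∀ s, MeasurableSet s → ς s = ∫⁻ z, L z (Prod.mk z ⁻¹' s) ∂μ₀)
    (hL : ∀ᵐ z ∂μ₀, L z = Q₀.withDensity fun v => ENNReal.ofReal (Real.exp (-Φ z v) / c v))
    (hZ : ∀ᵐ v ∂Q₀, 0 < normConst μ₀ Φ v) :
    ∃ κ : Kernel Y X, IsMarkovKernel κ ∧ ς.map Prod.swap = ς.snd ⊗ₘ κ ∧
      ∀ᵐ v ∂ς.snd, 0 < normConst μ₀ Φ v ∧ normConst μ₀ Φ v < ∞ ∧ κ v ≪ μ₀ ∧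
        (κ v).rnDeriv μ₀ =ᵐ[μ₀] posteriorDensity μ₀ Φ v := by
  set Ψ : X × Y → ℝ := hΦm.mk _ with hΨ
  have hΨm : Measurable Ψ := hΦm.measurable_mk
  have hae : ∀ᵐ p ∂(μ₀.prod Q₀), Φ p.1 p.2 = Ψ p := hΦm.ae_eq_mk
  have hae1 : ∀ᵐ z ∂μ₀, ∀ᵐ v ∂Q₀, Φ z v = Ψ (z, v) := Measure.ae_ae_of_ae_prod hae
  have hae2 : ∀ᵐ v ∂Q₀, ∀ᵐ z ∂μ₀, Φ z v = Ψ (z, v) :=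
    Measure.ae_ae_of_ae_prod
      ((Measure.measurePreserving_swap (μ := Q₀) (ν := μ₀)).quasiMeasurePreserving.ae hae)
  let D : X → Y → ℝ≥0∞ := fun z v => ENNReal.ofReal (Real.exp (-Ψ (z, v)))
  let a : Y → ℝ≥0∞ := fun v => ENNReal.ofReal (c v)⁻¹
  have hD : Measurable (Function.uncurry D) := by
    change Measurable fun p : X × Y => ENNReal.ofReal (Real.exp (-Ψ (p.1, p.2)))
    fun_prop
  have ha : Measurable a := by fun_prop
  have ha0 : ∀ v, a v ≠ 0 := fun v => (ENNReal.ofReal_pos.2 (inv_pos.2 (hc0 v))).ne'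
  have hnorm : ∀ᵐ v ∂Q₀, ∫⁻ z, D z v ∂μ₀ = normConst μ₀ Φ v := by
    filter_upwards [hae2] with v hv
    refine lintegral_congr_ae ?_
    filter_upwards [hv] with z hz
    rw [hz]
  have hς' : ς = (μ₀.prod Q₀).withDensity fun p => D p.1 p.2 * a p.2 := by
    refine eq_withDensity_of_apply_eq_lintegral hς (hD.mul (ha.comp measurable_snd)) ?_
    filter_upwards [hL, hae1] with z h1 h2
    rw [h1]
    refine withDensity_congr_ae ?_
    filter_upwards [h2] with v hv
    rw [hv, div_eq_mul_inv, ENNReal.ofReal_mul (Real.exp_nonneg _)]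
  obtain ⟨κ, hκ, hcomp, hac, hd⟩ := exists_kernel_of_withDensity hD ha ha0 hς' (by
    filter_upwards [hZ, hnorm] with v h1 h2
    rwa [h2])
  refine ⟨κ, hκ, hcomp, hac.ae_le ?_⟩
  filter_upwards [hZ, hnorm, hd, hae2] with v h1 h2 h3 h4
  rw [h2] at h3
  refine ⟨h1, h3.1, ?_, ?_⟩
  · rw [h3.2]
    exact withDensity_absolutelyContinuous _ _
  · have hm : Measurable fun z => D z v / normConst μ₀ Φ v :=
      (hD.comp (measurable_id.prodMk measurable_const)).div_const _
    rw [h3.2]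
    refine (Measure.rnDeriv_withDensity μ₀ hm).trans ?_
    filter_upwards [h4] with z hz
    rw [posteriorDensity, hz]

end Bayes

/-! ### Continuous dependence of the posterior on the data -/

section WithDensity

variable {X : Type*} [MeasurableSpace X] {μ₀ : Measure X}

/-- The Hellinger distance may be computed from the densities with respect to any common reference
measure. -/
lemma hellinger_withDensity {p p' : X → ℝ} [IsFiniteMeasure μ₀]
    (hp : Measurable p) (hp' : Measurable p') (hp0 : ∀ x, 0 < p x) (hp0' : ∀ x, 0 < p' x)
    [IsFiniteMeasure (μ₀.withDensity fun x => ENNReal.ofReal (p x))]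
    [IsFiniteMeasure (μ₀.withDensity fun x => ENNReal.ofReal (p' x))] :
    hellinger (μ₀.withDensity fun x => ENNReal.ofReal (p x))
      (μ₀.withDensity fun x => ENNReal.ofReal (p' x))
      = Real.sqrt ((1 / 2) * ∫ x, (Real.sqrt (p x) - Real.sqrt (p' x)) ^ 2 ∂μ₀) := by
  set μ := μ₀.withDensity fun x => ENNReal.ofReal (p x) with hμ
  set μ' := μ₀.withDensity fun x => ENNReal.ofReal (p' x) with hμ'
  have hs0 : ∀ x, 0 < p x + p' x := fun x => add_pos (hp0 x) (hp0' x)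
  have hsum : μ + μ' = μ₀.withDensity fun x => ENNReal.ofReal (p x + p' x) := by
    rw [hμ, hμ', ← withDensity_add_left hp.ennreal_ofReal]
    congr 1
    ext x
    rw [Pi.add_apply, ENNReal.ofReal_add (hp0 x).le (hp0' x).le]
  have hrn : ∀ r : X → ℝ, Measurable r → (∀ x, 0 < r x) →
      (μ₀.withDensity fun x => ENNReal.ofReal (r x)).rnDeriv (μ + μ')
        =ᵐ[μ + μ'] fun x => ENNReal.ofReal (r x / (p x + p' x)) := by
    intro r hr hr0
    have h1 : (μ₀.withDensity fun x => ENNReal.ofReal (r x))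
        = (μ + μ').withDensity fun x => ENNReal.ofReal (r x / (p x + p' x)) := by
      rw [hsum, ← withDensity_mul _ (by fun_prop) (by fun_prop)]
      congr 1
      ext x
      rw [Pi.mul_apply, ← ENNReal.ofReal_mul (hs0 x).le, mul_div_cancel₀ _ (hs0 x).ne']
    rw [h1]
    exact Measure.rnDeriv_withDensity _ (by fun_prop)
  rw [hellinger]
  congr 2
  have h1 : ∫ x, (Real.sqrt (μ.rnDeriv (μ + μ') x).toReal
      - Real.sqrt (μ'.rnDeriv (μ + μ') x).toReal) ^ 2 ∂(μ + μ')
      = ∫ x, (Real.sqrt (p x / (p x + p' x)) - Real.sqrt (p' x / (p x + p' x))) ^ 2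
        ∂(μ + μ') := by
    refine integral_congr_ae ?_
    filter_upwards [hrn p hp hp0, hrn p' hp' hp0'] with x h1 h2
    rw [h1, h2, ENNReal.toReal_ofReal (div_pos (hp0 x) (hs0 x)).le,
      ENNReal.toReal_ofReal (div_pos (hp0' x) (hs0 x)).le]
  rw [h1, hsum, integral_withDensity_eq_integral_toReal_smul (by fun_prop)
    (ae_of_all _ fun x => ENNReal.ofReal_lt_top)]
  refine integral_congr_ae (ae_of_all _ fun x => ?_)
  simp only [smul_eq_mul]
  rw [ENNReal.toReal_ofReal (hs0 x).le, Real.sqrt_div (hp0 x).le, Real.sqrt_div (hp0' x).le,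
    ← sub_div, div_pow, Real.sq_sqrt (hs0 x).le, mul_div_cancel₀ _ (hs0 x).ne']

end WithDensity

section Bounds

lemma abs_exp_sub_exp_le {s t M : ℝ} (hs : Real.exp s ≤ M) (ht : Real.exp t ≤ M) :
    |Real.exp s - Real.exp t| ≤ M * |s - t| := by
  wlog h : s ≤ t generalizing s t
  · rw [abs_sub_comm, abs_sub_comm s]
    exact this ht hs (le_of_not_ge h)
  have h1 : Real.exp t - Real.exp s ≤ Real.exp t * (t - s) := by
    have h2 : Real.exp s = Real.exp t * Real.exp (s - t) := by
      rw [← Real.exp_add]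
      congr 1
      ring
    rw [h2]
    nlinarith [Real.add_one_le_exp (s - t), Real.exp_pos t]
  rw [abs_sub_comm, abs_sub_comm s, abs_of_nonneg (sub_nonneg.2 (Real.exp_le_exp.2 h)),
    abs_of_nonneg (sub_nonneg.2 h)]
  exact h1.trans (mul_le_mul_of_nonneg_right ht (sub_nonneg.2 h))

lemma exists_one_add_rpow_le {q a : ℝ} (hq : 0 ≤ q) (ha : 0 < a) :
    ∃ K > 0, ∀ t : ℝ, 0 ≤ t → 1 + t ^ q ≤ K * Real.exp (a * t ^ 2) := by
  refine ⟨2 * Real.exp (q ^ 2 / (4 * a)), by positivity, fun t ht => ?_⟩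
  have h1 : t ^ q ≤ Real.exp (t * q) := by
    rw [Real.exp_mul]
    exact Real.rpow_le_rpow ht ((by linarith : t ≤ t + 1).trans (Real.add_one_le_exp t)) hq
  have h2 : t * q ≤ q ^ 2 / (4 * a) + a * t ^ 2 := by
    rw [← sub_nonneg]
    have : q ^ 2 / (4 * a) + a * t ^ 2 - t * q = (2 * a * t - q) ^ 2 / (4 * a) := by
      field_simp
      ring
    rw [this]
    positivity
  have h3 : (1 : ℝ) ≤ Real.exp (q ^ 2 / (4 * a) + a * t ^ 2) := Real.one_le_exp (by positivity)
  rw [mul_assoc, ← Real.exp_add]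
  linarith [Real.exp_le_exp.2 h2]

end Bounds

section WellPosed

variable {X Y : Type*} [NormedAddCommGroup X] [NormedAddCommGroup Y] {Φ : X → Y → ℝ}

lemma PotentialBounds.continuous_left (h : PotentialBounds Φ) (v : Y) :
    Continuous fun x => Φ x v := by
  refine continuous_iff_continuousAt.2 fun x => ?_
  set r := ‖x‖ + ‖v‖ + 1 with hr
  have hr0 : 0 < r := by positivity
  obtain ⟨K, hK, hL⟩ := h.lipschitz_left r hr0
  have hlip : LipschitzOnWith (Real.toNNReal K) (fun x => Φ x v) (Metric.ball 0 r) := by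
    refine LipschitzOnWith.of_dist_le_mul fun x₁ h₁ x₂ h₂ => ?_
    rw [Real.coe_toNNReal _ hK.le, Real.dist_eq, dist_eq_norm]
    exact hL x₁ x₂ v (mem_ball_zero_iff.1 h₁) (mem_ball_zero_iff.1 h₂)
      (by rw [hr]; linarith [norm_nonneg x])
  refine hlip.continuousOn.continuousAt (Metric.isOpen_ball.mem_nhds ?_)
  rw [mem_ball_zero_iff, hr]
  linarith [norm_nonneg v]

/-- Growth and Lipschitz bounds on the potential in terms of the single weight `exp (a ‖x‖²)`. -/
lemma PotentialBounds.exists_exp_bounds (h : PotentialBounds Φ) {a r : ℝ} (ha : 0 < a)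
    (hr : 0 < r) :
    ∃ A > 0, ∃ B > 0, ∀ v v' : Y, ‖v‖ < r → ‖v'‖ < r → ∀ x : X,
      Real.exp (-Φ x v) ≤ A * Real.exp (a * ‖x‖ ^ 2) ∧
      |Φ x v - Φ x v'| ≤ B * Real.exp (a * ‖x‖ ^ 2) * ‖v - v'‖ := by
  obtain ⟨M, hM⟩ := h.lower a ha r hr
  obtain ⟨q, hq, hK⟩ := h.lipschitz_right
  obtain ⟨K, hK0, hK⟩ := hK r hr
  obtain ⟨D, hD0, hD⟩ := exists_one_add_rpow_le hq ha
  refine ⟨Real.exp (-M), Real.exp_pos _, K * D, by positivity, fun v v' hv hv' x => ⟨?_, ?_⟩⟩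
  · rw [← Real.exp_add, Real.exp_le_exp]
    linarith [hM x v hv]
  · refine (hK v v' x hv hv').trans ?_
    rw [mul_assoc K D]
    gcongr
    exact hD _ (norm_nonneg x)

variable [MeasurableSpace X] {μ₀ : Measure X}

/-- The normalising constant `Z(v)` as a real number. -/
noncomputable def evidence (μ₀ : Measure X) (Φ : X → Y → ℝ) (v : Y) : ℝ :=
  ∫ x, Real.exp (-Φ x v) ∂μ₀

/-- The real-valued density of the posterior with respect to the prior. -/
noncomputable def realDensity (μ₀ : Measure X) (Φ : X → Y → ℝ) (v : Y) (x : X) : ℝ :=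
  Real.exp (-Φ x v) / evidence μ₀ Φ v

/-- A weight `exp (a ‖x‖²)` whose fourth power is integrable dominates all the expressions in the
potential that occur in the stability estimates. -/
def IntegrableWeight (μ₀ : Measure X) (a : ℝ) : Prop :=
  0 < a ∧ Integrable (fun x => Real.exp (a * ‖x‖ ^ 2) ^ 4) μ₀

variable [BorelSpace X] {a : ℝ}

lemma IntegrableWeight.pow (hw : IntegrableWeight μ₀ a) {n : ℕ} (hn : n ≤ 4) :
    Integrable (fun x : X => Real.exp (a * ‖x‖ ^ 2) ^ n) μ₀ := by
  refine hw.2.mono' (by fun_prop) (ae_of_all _ fun x => ?_)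
  have h1 : 1 ≤ Real.exp (a * ‖x‖ ^ 2) := Real.one_le_exp (mul_nonneg hw.1.le (sq_nonneg _))
  rw [Real.norm_of_nonneg (by positivity)]
  exact pow_le_pow_right₀ h1 hn

/-- Gaussian measures have integrable weights, by Fernique's theorem. -/
lemma exists_integrableWeight {E : Type*} [NormedAddCommGroup E] [NormedSpace ℝ E]
    [CompleteSpace E] [SecondCountableTopology E] [MeasurableSpace E] [BorelSpace E]
    (μ : Measure E) [IsGaussian μ] : ∃ a, IntegrableWeight μ a := by
  obtain ⟨C, hC, hI⟩ := IsGaussian.exists_integrable_exp_sq μ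
  refine ⟨C / 4, by positivity, ?_⟩
  convert! hI using 2 with x
  rw [← Real.exp_nat_mul]
  congr 1
  push_cast
  ring

lemma PotentialBounds.integrable_exp_neg (h : PotentialBounds Φ) (hw : IntegrableWeight μ₀ a)
    (v : Y) : Integrable (fun x => Real.exp (-Φ x v)) μ₀ := by
  have hr : 0 < ‖v‖ + 1 := by positivity
  obtain ⟨A, hA, B, hB, hAB⟩ := h.exists_exp_bounds hw.1 hr
  have hm : Measurable fun x => Φ x v := (h.continuous_left v).measurable
  refine ((hw.pow (n := 1) (by norm_num)).const_mul A).mono' (by fun_prop)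
    (ae_of_all _ fun x => ?_)
  rw [Real.norm_of_nonneg (Real.exp_nonneg _), pow_one]
  exact (hAB v v (by linarith) (by linarith) x).1

variable [IsProbabilityMeasure μ₀]

lemma PotentialBounds.evidence_pos (h : PotentialBounds Φ) (hw : IntegrableWeight μ₀ a) (v : Y) :
    0 < evidence μ₀ Φ v :=
  integral_exp_pos (h.integrable_exp_neg hw v)

omit [IsProbabilityMeasure μ₀] in
lemma PotentialBounds.normConst_eq (h : PotentialBounds Φ) (hw : IntegrableWeight μ₀ a) (v : Y) :
    normConst μ₀ Φ v = ENNReal.ofReal (evidence μ₀ Φ v) := by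
  rw [normConst, evidence, ofReal_integral_eq_lintegral_ofReal (h.integrable_exp_neg hw v)
    (ae_of_all _ fun x => Real.exp_nonneg _)]

lemma PotentialBounds.posterior_eq (h : PotentialBounds Φ) (hw : IntegrableWeight μ₀ a) (v : Y) :
    posterior μ₀ Φ v = μ₀.withDensity fun x => ENNReal.ofReal (realDensity μ₀ Φ v x) := by
  rw [posterior]
  congr 1
  ext x
  rw [posteriorDensity, h.normConst_eq hw, realDensity,
    ENNReal.ofReal_div_of_pos (h.evidence_pos hw v)]

lemma PotentialBounds.realDensity_pos (h : PotentialBounds Φ) (hw : IntegrableWeight μ₀ a)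
    (v : Y) (x : X) : 0 < realDensity μ₀ Φ v x :=
  div_pos (Real.exp_pos _) (h.evidence_pos hw v)

omit [IsProbabilityMeasure μ₀] in
lemma PotentialBounds.measurable_realDensity (h : PotentialBounds Φ) (v : Y) :
    Measurable (realDensity μ₀ Φ v) := by
  have hm : Measurable fun x => Φ x v := (h.continuous_left v).measurable
  unfold realDensity
  fun_prop

lemma PotentialBounds.isProbabilityMeasure_posterior (h : PotentialBounds Φ)
    (hw : IntegrableWeight μ₀ a) (v : Y) : IsProbabilityMeasure (posterior μ₀ Φ v) := by
  refine ⟨?_⟩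
  have h0 : normConst μ₀ Φ v ≠ 0 := by
    rw [h.normConst_eq hw]
    exact (ENNReal.ofReal_pos.2 (h.evidence_pos hw v)).ne'
  have h1 : normConst μ₀ Φ v ≠ ∞ := by
    rw [h.normConst_eq hw]
    exact ENNReal.ofReal_ne_top
  have hm : Measurable fun x => Φ x v := (h.continuous_left v).measurable
  rw [posterior, withDensity_apply _ MeasurableSet.univ, Measure.restrict_univ]
  simp_rw [posteriorDensity, div_eq_mul_inv]
  rw [lintegral_mul_const _ (by fun_prop)]
  exact ENNReal.mul_inv_cancel h0 h1

/-- The evidence is bounded below on bounded sets of data. -/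
lemma PotentialBounds.exists_le_evidence (h : PotentialBounds Φ) (hw : IntegrableWeight μ₀ a)
    {r : ℝ} (hr : 0 < r) : ∃ z > 0, ∀ v : Y, ‖v‖ < r → z ≤ evidence μ₀ Φ v := by
  obtain ⟨p, hp, hK⟩ := h.upper
  obtain ⟨K, hK0, hK⟩ := hK r hr
  have hI : Integrable (fun x : X => Real.exp (-(K * (1 + ‖x‖ ^ p)))) μ₀ := by
    refine Integrable.of_bound (C := 1) (Measurable.aestronglyMeasurable (by fun_prop))
      (ae_of_all _ fun x => ?_)
    rw [Real.norm_of_nonneg (Real.exp_nonneg _)]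
    exact Real.exp_le_one_iff.2 (neg_nonpos.2 (by positivity))
  refine ⟨_, integral_exp_pos hI, fun v hv => ?_⟩
  refine integral_mono hI (h.integrable_exp_neg hw v) fun x => ?_
  exact Real.exp_le_exp.2 (neg_le_neg (hK x v hv))

lemma abs_log_sub_log_le {z s t : ℝ} (hz : 0 < z) (hs : z ≤ s) (ht : z ≤ t) :
    |Real.log s - Real.log t| ≤ |s - t| / z := by
  have key : ∀ {s t : ℝ}, z ≤ s → z ≤ t → Real.log s - Real.log t ≤ |s - t| / z := by
    intro s t hs ht
    have hs0 := hz.trans_le hs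
    have ht0 := hz.trans_le ht
    rw [← Real.log_div hs0.ne' ht0.ne']
    calc Real.log (s / t) ≤ s / t - 1 := Real.log_le_sub_one_of_pos (by positivity)
      _ = (s - t) / t := by field_simp
      _ ≤ |s - t| / t := by gcongr; exact le_abs_self _
      _ ≤ |s - t| / z := by gcongr
  refine abs_le.2 ⟨?_, key hs ht⟩
  have := key ht hs
  rw [abs_sub_comm] at this
  linarith

/-- Lipschitz bounds for the density and for its square root. They follow from the
representation `exp (-Ψ)` of the density, with `Ψ = Φ + log Z`: the logarithm of the evidence is
Lipschitz on bounded sets, so that `Ψ` inherits the bounds on `Φ`. -/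
lemma PotentialBounds.exists_density_bounds (h : PotentialBounds Φ) (hw : IntegrableWeight μ₀ a)
    {r : ℝ} (hr : 0 < r) :
    ∃ A > 0, ∃ B > 0, ∀ v v' : Y, ‖v‖ < r → ‖v'‖ < r → ∀ x : X,
      realDensity μ₀ Φ v x ≤ A * Real.exp (a * ‖x‖ ^ 2) ∧
      |realDensity μ₀ Φ v x - realDensity μ₀ Φ v' x|
        ≤ A * B * Real.exp (a * ‖x‖ ^ 2) ^ 2 * ‖v - v'‖ ∧
      (Real.sqrt (realDensity μ₀ Φ v x) - Real.sqrt (realDensity μ₀ Φ v' x)) ^ 2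
        ≤ A * B ^ 2 * Real.exp (a * ‖x‖ ^ 2) ^ 3 * ‖v - v'‖ ^ 2 := by
  obtain ⟨A, hA, B, hB, hAB⟩ := h.exists_exp_bounds hw.1 hr
  obtain ⟨z, hz, hzv⟩ := h.exists_le_evidence hw hr
  set e : X → ℝ := fun x => Real.exp (a * ‖x‖ ^ 2) with he
  have he1 : ∀ x, 1 ≤ e x := fun x => Real.one_le_exp (mul_nonneg hw.1.le (sq_nonneg _))
  set I := ∫ x, e x ^ 2 ∂μ₀ with hI
  have hI0 : 0 ≤ I := integral_nonneg fun x => by positivity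
  -- the evidence is Lipschitz on bounded sets
  have hZ : ∀ v v' : Y, ‖v‖ < r → ‖v'‖ < r →
      |evidence μ₀ Φ v - evidence μ₀ Φ v'| ≤ A * B * I * ‖v - v'‖ := by
    intro v v' hv hv'
    rw [evidence, evidence, ← integral_sub (h.integrable_exp_neg hw v)
      (h.integrable_exp_neg hw v'), ← Real.norm_eq_abs]
    calc ‖∫ x, (Real.exp (-Φ x v) - Real.exp (-Φ x v')) ∂μ₀‖
        ≤ ∫ x, A * B * ‖v - v'‖ * e x ^ 2 ∂μ₀ := by
          refine norm_integral_le_of_norm_le ((hw.pow (by norm_num)).const_mul _)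
            (ae_of_all _ fun x => ?_)
          refine (abs_exp_sub_exp_le (hAB v v' hv hv' x).1 (hAB v' v hv' hv x).1).trans ?_
          have h1 := (hAB v v' hv hv' x).2
          rw [neg_sub_neg, abs_sub_comm]
          calc A * e x * |Φ x v - Φ x v'| ≤ A * e x * (B * e x * ‖v - v'‖) := by gcongr
            _ = A * B * ‖v - v'‖ * e x ^ 2 := by ring
      _ = A * B * I * ‖v - v'‖ := by
          rw [integral_const_mul]
          ring
  set B' := B + A * B * I / z with hB'
  have hB'0 : 0 < B' := by positivity
  set Ψ : Y → X → ℝ := fun v x => Φ x v + Real.log (evidence μ₀ Φ v) with hΨ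
  have hdens : ∀ v x, realDensity μ₀ Φ v x = Real.exp (-Ψ v x) := by
    intro v x
    rw [realDensity, hΨ]
    simp only
    rw [neg_add, Real.exp_add, Real.exp_neg (Real.log _), Real.exp_log (h.evidence_pos hw v),
      div_eq_mul_inv]
  have hΨL : ∀ v v' : Y, ‖v‖ < r → ‖v'‖ < r → ∀ x,
      |Ψ v x - Ψ v' x| ≤ B' * e x * ‖v - v'‖ := by
    intro v v' hv hv' x
    have h1 := (hAB v v' hv hv' x).2
    have h2 := abs_log_sub_log_le hz (hzv v hv) (hzv v' hv')
    have h3 : |evidence μ₀ Φ v - evidence μ₀ Φ v'| / z ≤ A * B * I * ‖v - v'‖ / z := by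
      gcongr
      exact hZ v v' hv hv'
    calc |Ψ v x - Ψ v' x|
        = |(Φ x v - Φ x v') + (Real.log (evidence μ₀ Φ v) - Real.log (evidence μ₀ Φ v'))| := by
          congr 1
          simp only [hΨ]
          ring
      _ ≤ B * e x * ‖v - v'‖ + A * B * I * ‖v - v'‖ / z :=
          (abs_add_le _ _).trans (add_le_add h1 (h2.trans h3))
      _ = B * e x * ‖v - v'‖ + A * B * I / z * 1 * ‖v - v'‖ := by ring
      _ ≤ B * e x * ‖v - v'‖ + A * B * I / z * e x * ‖v - v'‖ := by
          gcongr
          exact he1 x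
      _ = B' * e x * ‖v - v'‖ := by rw [hB']; ring
  have hup : ∀ v : Y, ‖v‖ < r → ∀ x, realDensity μ₀ Φ v x ≤ A / z * e x := by
    intro v hv x
    calc realDensity μ₀ Φ v x ≤ A * e x / z :=
          div_le_div₀ (by positivity) (hAB v v hv hv x).1 hz (hzv v hv)
      _ = A / z * e x := by ring
  refine ⟨A / z, by positivity, B', hB'0, fun v v' hv hv' x => ⟨hup v hv x, ?_, ?_⟩⟩
  · have h1 := hup v hv x
    have h2 := hup v' hv' x
    rw [hdens] at h1 h2
    rw [hdens, hdens]
    refine (abs_exp_sub_exp_le h1 h2).trans ?_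
    rw [neg_sub_neg, abs_sub_comm]
    calc A / z * e x * |Ψ v x - Ψ v' x| ≤ A / z * e x * (B' * e x * ‖v - v'‖) := by
          gcongr
          exact hΨL v v' hv hv' x
      _ = A / z * B' * e x ^ 2 * ‖v - v'‖ := by ring
  · have hsq : ∀ v, Real.sqrt (realDensity μ₀ Φ v x) = Real.exp (-Ψ v x / 2) := fun v => by
      rw [hdens, Real.exp_half]
    have h1 := Real.sqrt_le_sqrt (hup v hv x)
    have h2 := Real.sqrt_le_sqrt (hup v' hv' x)
    rw [hsq] at h1 h2
    have h3 := abs_exp_sub_exp_le h1 h2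
    rw [hsq, hsq, ← sq_abs]
    have h4 : |-Ψ v x / 2 - -Ψ v' x / 2| ≤ B' * e x * ‖v - v'‖ := by
      have h5 : -Ψ v x / 2 - -Ψ v' x / 2 = -((Ψ v x - Ψ v' x) / 2) := by ring
      rw [h5, abs_neg, abs_div, abs_two]
      linarith [hΨL v v' hv hv' x, abs_nonneg (Ψ v x - Ψ v' x)]
    have he0 : 0 ≤ A / z * e x := by positivity
    calc |Real.exp (-Ψ v x / 2) - Real.exp (-Ψ v' x / 2)| ^ 2
        ≤ (Real.sqrt (A / z * e x) * (B' * e x * ‖v - v'‖)) ^ 2 := by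
          gcongr
          exact h3.trans (by gcongr)
      _ = A / z * B' ^ 2 * e x ^ 3 * ‖v - v'‖ ^ 2 := by
          rw [mul_pow, Real.sq_sqrt he0]
          ring

theorem PotentialBounds.exists_hellinger_le (h : PotentialBounds Φ) (hw : IntegrableWeight μ₀ a)
    {r : ℝ} (hr : 0 < r) : ∃ C : ℝ, 0 < C ∧ ∀ v v' : Y, ‖v‖ ≤ r → ‖v'‖ ≤ r →
      hellinger (posterior μ₀ Φ v) (posterior μ₀ Φ v') ≤ C * ‖v - v'‖ := by
  obtain ⟨A, hA, B, hB, hAB⟩ := h.exists_density_bounds hw (by linarith : 0 < r + 1)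
  set I := ∫ x : X, Real.exp (a * ‖x‖ ^ 2) ^ 3 ∂μ₀ with hI
  have hI0 : 0 ≤ I := integral_nonneg fun x => by positivity
  refine ⟨Real.sqrt (A * B ^ 2 * I) + 1, by positivity, fun v v' hv hv' => ?_⟩
  have hP := h.isProbabilityMeasure_posterior hw v
  have hP' := h.isProbabilityMeasure_posterior hw v'
  rw [h.posterior_eq hw] at hP hP' ⊢
  rw [h.posterior_eq hw v', hellinger_withDensity (h.measurable_realDensity v)
    (h.measurable_realDensity v') (h.realDensity_pos hw v) (h.realDensity_pos hw v')]
  have h1 : ∫ x, (Real.sqrt (realDensity μ₀ Φ v x) - Real.sqrt (realDensity μ₀ Φ v' x)) ^ 2 ∂μ₀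
      ≤ A * B ^ 2 * I * ‖v - v'‖ ^ 2 := by
    calc _ ≤ ∫ x : X, A * B ^ 2 * ‖v - v'‖ ^ 2 * Real.exp (a * ‖x‖ ^ 2) ^ 3 ∂μ₀ := by
          refine integral_mono_of_nonneg (ae_of_all _ fun x => sq_nonneg _)
            ((hw.pow (by norm_num)).const_mul _) (ae_of_all _ fun x => ?_)
          refine (hAB v v' (by linarith) (by linarith) x).2.2.trans (le_of_eq ?_)
          ring
      _ = A * B ^ 2 * I * ‖v - v'‖ ^ 2 := by
          rw [integral_const_mul]
          ring
  have h0 : 0 ≤ ∫ x, (Real.sqrt (realDensity μ₀ Φ v x)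
      - Real.sqrt (realDensity μ₀ Φ v' x)) ^ 2 ∂μ₀ := integral_nonneg fun x => sq_nonneg _
  calc _ ≤ Real.sqrt (A * B ^ 2 * I * ‖v - v'‖ ^ 2) := Real.sqrt_le_sqrt (by linarith)
    _ = Real.sqrt (A * B ^ 2 * I) * ‖v - v'‖ := by
        rw [Real.sqrt_mul (by positivity), Real.sqrt_sq (norm_nonneg _)]
    _ ≤ (Real.sqrt (A * B ^ 2 * I) + 1) * ‖v - v'‖ := by
        gcongr
        linarith

variable {F : Type*} [NormedAddCommGroup F] [NormedSpace ℝ F] {f : X → F}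

/-- Functions of polynomial growth are integrable against every posterior, and their posterior
means are locally Lipschitz in the data. -/
theorem PotentialBounds.integrable_and_continuous_integral (h : PotentialBounds Φ)
    (hw : IntegrableWeight μ₀ a) (hf : AEStronglyMeasurable f μ₀)
    (hfK : ∃ (K : ℝ) (n : ℕ), ∀ z, ‖f z‖ ≤ K * (1 + ‖z‖ ^ n)) :
    (∀ v, Integrable f (posterior μ₀ Φ v)) ∧
      Continuous fun v => ∫ z, f z ∂(posterior μ₀ Φ v) := by
  obtain ⟨K, n, hK⟩ := hfK
  obtain ⟨D, hD0, hD⟩ := exists_one_add_rpow_le (Nat.cast_nonneg n) hw.1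
  have hfe : ∀ x, ‖f x‖ ≤ |K| * D * Real.exp (a * ‖x‖ ^ 2) := by
    intro x
    have h1 := hD ‖x‖ (norm_nonneg x)
    rw [Real.rpow_natCast] at h1
    calc ‖f x‖ ≤ K * (1 + ‖x‖ ^ n) := hK x
      _ ≤ |K| * (1 + ‖x‖ ^ n) := by
          gcongr
          exact le_abs_self K
      _ ≤ |K| * (D * Real.exp (a * ‖x‖ ^ 2)) := by gcongr
      _ = _ := by ring
  have hsm : ∀ v, AEStronglyMeasurable (fun x => realDensity μ₀ Φ v x • f x) μ₀ := fun v =>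
    (h.measurable_realDensity v).aestronglyMeasurable.smul hf
  have hint : ∀ v, Integrable (fun x => realDensity μ₀ Φ v x • f x) μ₀ := by
    intro v
    obtain ⟨A, hA, B, hB, hAB⟩ := h.exists_density_bounds hw (by positivity : 0 < ‖v‖ + 1)
    refine ((hw.pow (n := 2) (by norm_num)).const_mul (A * (|K| * D))).mono' (hsm v)
      (ae_of_all _ fun x => ?_)
    rw [norm_smul, Real.norm_of_nonneg (h.realDensity_pos hw v x).le]
    calc realDensity μ₀ Φ v x * ‖f x‖
        ≤ (A * Real.exp (a * ‖x‖ ^ 2)) * (|K| * D * Real.exp (a * ‖x‖ ^ 2)) := by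
          gcongr
          · exact (hAB v v (by linarith) (by linarith) x).1
          · exact hfe x
      _ = _ := by ring
  have hof : ∀ v x, (ENNReal.ofReal (realDensity μ₀ Φ v x)).toReal = realDensity μ₀ Φ v x :=
    fun v x => ENNReal.toReal_ofReal (h.realDensity_pos hw v x).le
  have hpost : ∀ v, ∫ z, f z ∂(posterior μ₀ Φ v) = ∫ x, realDensity μ₀ Φ v x • f x ∂μ₀ := by
    intro v
    rw [h.posterior_eq hw, integral_withDensity_eq_integral_toReal_smul
      (h.measurable_realDensity v).ennreal_ofReal (ae_of_all _ fun x => ENNReal.ofReal_lt_top)]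
    simp_rw [hof]
  refine ⟨fun v => ?_, ?_⟩
  · rw [h.posterior_eq hw, integrable_withDensity_iff_integrable_smul'
      (h.measurable_realDensity v).ennreal_ofReal (ae_of_all _ fun x => ENNReal.ofReal_lt_top)]
    simp_rw [hof]
    exact hint v
  · refine continuous_iff_continuousAt.2 fun v₀ => ?_
    set r := ‖v₀‖ + 1 with hr
    have hr0 : 0 < r := by positivity
    obtain ⟨A, hA, B, hB, hAB⟩ := h.exists_density_bounds hw hr0
    set I := ∫ x : X, Real.exp (a * ‖x‖ ^ 2) ^ 3 ∂μ₀ with hI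
    have hI0 : 0 ≤ I := integral_nonneg fun x => by positivity
    have hlip : LipschitzOnWith (Real.toNNReal (A * B * (|K| * D) * I))
        (fun v => ∫ z, f z ∂(posterior μ₀ Φ v)) (Metric.ball 0 r) := by
      refine LipschitzOnWith.of_dist_le_mul fun v hv v' hv' => ?_
      rw [mem_ball_zero_iff] at hv hv'
      rw [Real.coe_toNNReal _ (by positivity), dist_eq_norm, dist_eq_norm, hpost, hpost,
        ← integral_sub (hint v) (hint v')]
      calc ‖∫ x, (realDensity μ₀ Φ v x • f x - realDensity μ₀ Φ v' x • f x) ∂μ₀‖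
          ≤ ∫ x : X, A * B * (|K| * D) * ‖v - v'‖ * Real.exp (a * ‖x‖ ^ 2) ^ 3 ∂μ₀ := by
            refine norm_integral_le_of_norm_le ((hw.pow (by norm_num)).const_mul _)
              (ae_of_all _ fun x => ?_)
            rw [← sub_smul, norm_smul, Real.norm_eq_abs]
            calc _ ≤ (A * B * Real.exp (a * ‖x‖ ^ 2) ^ 2 * ‖v - v'‖)
                  * (|K| * D * Real.exp (a * ‖x‖ ^ 2)) := by
                  gcongr
                  · exact (hAB v v' hv hv' x).2.1
                  · exact hfe x
              _ = _ := by ring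
        _ = A * B * (|K| * D) * I * ‖v - v'‖ := by
            rw [integral_const_mul]
            ring
    refine hlip.continuousOn.continuousAt (Metric.isOpen_ball.mem_nhds ?_)
    rw [mem_ball_zero_iff, hr]
    linarith

end WellPosed

section Moments

variable {X : Type*} [NormedAddCommGroup X] [InnerProductSpace ℝ X] [CompleteSpace X]
  [SecondCountableTopology X] [MeasurableSpace X] [BorelSpace X]

omit [SecondCountableTopology X] in
/-- The covariance operator as a Bochner integral, `E z ⊗ z - E z ⊗ E z`. -/
lemma covOp_eq {μ : Measure X} [IsProbabilityMeasure μ] (hμ : MemLp id 2 μ)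
    (hint : Integrable (fun z : X => InnerProductSpace.rankOne ℝ z z) μ) :
    covOp μ = (∫ z, InnerProductSpace.rankOne ℝ z z ∂μ)
      - InnerProductSpace.rankOne ℝ (∫ z, z ∂μ) (∫ z, z ∂μ) := by
  refine ContinuousLinearMap.ext fun u => ext_inner_right ℝ fun w => ?_
  have hi : Integrable (fun z : X => z) μ := hμ.integrable (by norm_num)
  have hL : ∀ v : X, MemLp (fun z => inner ℝ v z) 2 μ := fun v => hμ.const_inner v
  rw [covOp, InnerProductSpace.continuousLinearMapOfBilin_apply,
    covarianceBilin_apply_eq_cov hμ, covariance_eq_sub (hL u) (hL w),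
    sub_apply, inner_sub_left, ContinuousLinearMap.integral_apply hint,
    real_inner_comm, ← integral_inner (hint.apply_continuousLinearMap u),
    integral_inner hi, integral_inner hi]
  simp [inner_smul_left, inner_smul_right, real_inner_comm]

variable {Y : Type*} [NormedAddCommGroup Y] {Φ : X → Y → ℝ} {μ₀ : Measure X}
  [IsProbabilityMeasure μ₀] {a : ℝ}

omit [InnerProductSpace ℝ X] [CompleteSpace X] in
lemma PotentialBounds.memLp_two (h : PotentialBounds Φ) (hw : IntegrableWeight μ₀ a) (v : Y) :
    MemLp id 2 (posterior μ₀ Φ v) := by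
  rw [memLp_two_iff_integrable_sq_norm aestronglyMeasurable_id]
  refine (h.integrable_and_continuous_integral (f := fun z : X => ‖id z‖ ^ 2) hw
    (by fun_prop) ⟨1, 2, fun z => ?_⟩).1 v
  simp

omit [CompleteSpace X] in
lemma PotentialBounds.continuous_mean (h : PotentialBounds Φ) (hw : IntegrableWeight μ₀ a) :
    Continuous fun v => ∫ z, z ∂(posterior μ₀ Φ v) :=
  (h.integrable_and_continuous_integral (f := fun z : X => z) hw
    aestronglyMeasurable_id ⟨1, 1, fun z => by simp⟩).2

theorem PotentialBounds.continuous_covOp (h : PotentialBounds Φ) (hw : IntegrableWeight μ₀ a) :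
    Continuous fun v => covOp (posterior μ₀ Φ v) := by
  have hc : Continuous fun z : X => InnerProductSpace.rankOne ℝ z z :=
    ((InnerProductSpace.rankOne ℝ (E := X) (F := X)).continuous).clm_apply continuous_id
  obtain ⟨h1, h2⟩ := h.integrable_and_continuous_integral hw hc.aestronglyMeasurable
    ⟨1, 2, fun z => by simp [sq]⟩
  have hm := h.continuous_mean hw
  have heq : (fun v => covOp (posterior μ₀ Φ v)) = fun v =>
      (∫ z, InnerProductSpace.rankOne ℝ z z ∂(posterior μ₀ Φ v))
        - InnerProductSpace.rankOne ℝ (∫ z, z ∂(posterior μ₀ Φ v))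
          (∫ z, z ∂(posterior μ₀ Φ v)) := by
    ext1 v
    have := h.isProbabilityMeasure_posterior hw v
    exact covOp_eq (h.memLp_two hw v) (h1 v)
  rw [heq]
  exact h2.sub (hc.comp hm)

end Moments

end ModelErrorBayes

theorem mainTheorem3
    {Ω : Type*} [MeasurableSpace Ω] (P : Measure Ω) [IsProbabilityMeasure P]
    {X : Type*} [NormedAddCommGroup X] [InnerProductSpace ℝ X] [CompleteSpace X]
    [SecondCountableTopology X] [MeasurableSpace X] [BorelSpace X]
    {F : Type*} [NormedAddCommGroup F] [NormedSpace ℝ F] [CompleteSpace F]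
    {J : ℕ}
    -- the model `y = G x + ε + η`
    (G : X → EuclideanSpace ℝ (Fin J)) (hG : Measurable G)
    (x : Ω → X) (ε η : Ω → EuclideanSpace ℝ (Fin J))
    (hx : Measurable x) (hε : Measurable ε) (hη : Measurable η)
    (hεx : HasGaussianLaw (fun ω => (ε ω, x ω)) P)
    (hηG : HasGaussianLaw η P) (hη0 : ∫ ω, η ω ∂P = 0)
    (hind : IndepFun η (fun ω => (ε ω, x ω)) P)
    -- the range and Hilbert-Schmidt conditions
    (h1 : ModelErrorBayes.rangeSqrt (ModelErrorBayes.covMatrix P η)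
      = ModelErrorBayes.rangeSqrt (ModelErrorBayes.covNu P x ε η))
    (h2 : ∀ᵐ z ∂(P.map x), G z + ModelErrorBayes.nuBar P x ε z
      ∈ ModelErrorBayes.rangeSqrt (ModelErrorBayes.covMatrix P η))
    (h3 : ModelErrorBayes.IsHilbertSchmidtOn
      (Matrix.toEuclideanLin (ModelErrorBayes.feldmanHajekOp
        (ModelErrorBayes.covMatrix P η) (ModelErrorBayes.covNu P x ε η)))
      (ModelErrorBayes.rangeSqrt (ModelErrorBayes.covMatrix P η)).topologicalClosure)
    -- the potential
    (Φ : X → EuclideanSpace ℝ (Fin J) → ℝ)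
    (hΦm : AEMeasurable (fun p : X × EuclideanSpace ℝ (Fin J) => Φ p.1 p.2)
      ((P.map x).prod (P.map η)))
    (c : EuclideanSpace ℝ (Fin J) → ℝ) (hc : Measurable c) (hc0 : ∀ v, 0 < c v)
    (hΦ : ∀ᵐ z ∂(P.map x), ∀ᵐ v ∂(P.map η),
      (ModelErrorBayes.condLaw P G x ε η z).rnDeriv (P.map η) v
        = ENNReal.ofReal (Real.exp (-Φ z v) / c v))
    (hZ : ∀ᵐ v ∂(P.map η), 0 < ModelErrorBayes.normConst (P.map x) Φ v) :
    -- the joint law of `(x, y)` is `μ₀(dx) N(G x + nuBar x, C_{ν|x})(dy)`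
    (∀ (A : Set X) (B : Set (EuclideanSpace ℝ (Fin J))), MeasurableSet A → MeasurableSet B →
      P.map (fun ω => (x ω, G (x ω) + ε ω + η ω)) (A ×ˢ B)
        = ∫⁻ z in A, ModelErrorBayes.condLaw P G x ε η z B ∂(P.map x)) ∧
    -- the conditional distribution of `x` given `y` exists and has the stated density
    (∃ κ : Kernel (EuclideanSpace ℝ (Fin J)) X, IsMarkovKernel κ ∧
      P.map (fun ω => (G (x ω) + ε ω + η ω, x ω))
        = (P.map (fun ω => G (x ω) + ε ω + η ω)).compProd κ ∧
      ∀ᵐ v ∂(P.map (fun ω => G (x ω) + ε ω + η ω)),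
        0 < ModelErrorBayes.normConst (P.map x) Φ v ∧
        ModelErrorBayes.normConst (P.map x) Φ v < ∞ ∧
        κ v ≪ P.map x ∧
        (κ v).rnDeriv (P.map x) =ᵐ[P.map x]
          ModelErrorBayes.posteriorDensity (P.map x) Φ v) ∧
    -- well-posedness with respect to the data
    (ModelErrorBayes.PotentialBounds Φ →
      (∀ v, 0 < ModelErrorBayes.normConst (P.map x) Φ v ∧
        ModelErrorBayes.normConst (P.map x) Φ v < ∞ ∧
        IsProbabilityMeasure (ModelErrorBayes.posterior (P.map x) Φ v)) ∧
      (∀ r : ℝ, 0 < r → ∃ C : ℝ, 0 < C ∧ ∀ v v' : EuclideanSpace ℝ (Fin J),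
        ‖v‖ ≤ r → ‖v'‖ ≤ r →
        ModelErrorBayes.hellinger (ModelErrorBayes.posterior (P.map x) Φ v)
          (ModelErrorBayes.posterior (P.map x) Φ v') ≤ C * ‖v - v'‖) ∧
      (∀ f : X → F, AEStronglyMeasurable f (P.map x) →
        (∃ (K : ℝ) (n : ℕ), ∀ z, ‖f z‖ ≤ K * (1 + ‖z‖ ^ n)) →
        (∀ v, Integrable f (ModelErrorBayes.posterior (P.map x) Φ v)) ∧
        Continuous fun v => ∫ z, f z ∂(ModelErrorBayes.posterior (P.map x) Φ v)) ∧
      (∀ v, MemLp id 2 (ModelErrorBayes.posterior (P.map x) Φ v)) ∧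
      (Continuous fun v => ∫ z, z ∂(ModelErrorBayes.posterior (P.map x) Φ v)) ∧
      (Continuous fun v =>
        ModelErrorBayes.covOp (ModelErrorBayes.posterior (P.map x) Φ v))) := by
  have hxG : IsGaussian (P.map x) := hεx.snd.isGaussian_map
  have hηP : IsProbabilityMeasure (P.map η) := hηG.isGaussian_map.toIsProbabilityMeasure
  have hxy : Measurable fun ω => (x ω, G (x ω) + ε ω + η ω) := by fun_prop
  have hjoint := fun (s : Set (X × EuclideanSpace ℝ (Fin J))) (hs : MeasurableSet s) =>
    ModelErrorBayes.map_prod_eq_lintegral_condLaw hG hx hε hη hεx hηG hη0 hind hs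
  refine ⟨fun A B hA hB => ?_, ?_, fun hb => ?_⟩
  · rw [hjoint _ (hA.prod hB), ← lintegral_indicator hA]
    refine lintegral_congr fun z => ?_
    by_cases hz : z ∈ A <;> simp [hz]
  · have : IsProbabilityMeasure (P.map fun ω => (x ω, G (x ω) + ε ω + η ω)) :=
      Measure.isProbabilityMeasure_map hxy.aemeasurable
    -- by absolute continuity, each conditional law is recovered from its Radon-Nikodym derivative
    have hL : ∀ᵐ z ∂(P.map x), ModelErrorBayes.condLaw P G x ε η z
        = (P.map η).withDensity fun v => ENNReal.ofReal (Real.exp (-Φ z v) / c v) := by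
      filter_upwards [h2, hΦ] with z hz hd
      have hac : ModelErrorBayes.condLaw P G x ε η z ≪ P.map η := by
        rw [ModelErrorBayes.map_eq_multivariateGaussian hηG hη0]
        exact ModelErrorBayes.multivariateGaussian_absolutelyContinuous h1 hz
      have : IsProbabilityMeasure (ModelErrorBayes.condLaw P G x ε η z) := by
        unfold ModelErrorBayes.condLaw
        infer_instance
      have := Measure.haveLebesgueDecomposition_of_sigmaFinite
        (ModelErrorBayes.condLaw P G x ε η z) (P.map η)
      rw [← Measure.withDensity_rnDeriv_eq _ _ hac]
      exact withDensity_congr_ae hd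
    obtain ⟨κ, hκ, hcomp, hae⟩ :=
      ModelErrorBayes.exists_kernel_posteriorDensity hΦm hc hc0 hjoint hL hZ
    rw [Measure.map_map measurable_swap hxy] at hcomp
    have hsnd : (P.map fun ω => (x ω, G (x ω) + ε ω + η ω)).snd
        = P.map fun ω => G (x ω) + ε ω + η ω :=
      Measure.snd_map_prodMk hx
    rw [hsnd] at hcomp hae
    exact ⟨κ, hκ, hcomp, hae⟩
  · obtain ⟨a, hw⟩ := ModelErrorBayes.exists_integrableWeight (P.map x)
    refine ⟨fun v => ⟨?_, ?_, hb.isProbabilityMeasure_posterior hw v⟩,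
      fun r hr => hb.exists_hellinger_le hw hr,
      fun f hf hK => hb.integrable_and_continuous_integral hw hf hK,
      hb.memLp_two hw, hb.continuous_mean hw, hb.continuous_covOp hw⟩
    · rw [hb.normConst_eq hw]
      exact ENNReal.ofReal_pos.2 (hb.evidence_pos hw v)
    · rw [hb.normConst_eq hw]
      exact ENNReal.ofReal_lt_top
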